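/- Let $N\in\mathbb N$ and $p\in\mathbb R$ with $1<p<N$, let $f:\mathbb R\to\mathbb R$, put $F(u)=\int_0^u f(s)\,ds$ and $\phi_p(s)=|s|^{p-2}s$ for $s\neq 0$, $\phi_p(0)=0$. Assume: (H1) $f$ is continuous on $\mathbb R$, locally Lipschitz on $\mathbb R\setminus\{0\}$, and $f(0)=0$; (H2) there are $b<0<a$ such that $f$ is strictly decreasing on $(b,a)$, and $a$ (resp. $b$) is a local minimum (resp. local maximum) of $f$; (H3) $u\mapsto|F(u)|^{-1/p}$ is integrable on a neighbourhood of $0$, and $u\mapsto|F(x_0)-F(u)|^{-1/p}$ (taken to be $+\infty$ where $F(u)=F(x_0)$) is integrable on a neighbourhood of $x_0$ for every local maximum $x_0\neq0$ of $F$; (H4) $F(u_0)<0$ for every $u_0\neq 0$ with $f(u_0)=0$; (H5) $f$ is nondecreasing on $[M,\infty)$ for some $M\in\mathbb R$, and $\displaystyle\liminf_{|u|\to\infty}\frac{f(u)}{|u|^{p-2}u}=\infty$. For $\lambda>0$, a solution with initial value $\lambda$ is a function $u\in C^1([0,\infty))$ with $\phi_p(u')\in C^1(0,\infty)$, $u(0)=\lambda$,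 $u'(0)=0$ and $$\left(r^{N-1}\phi_p(u')\right)'+r^{N-1}f(u)=0\qquad\text{for all } r>0 .$$ (Solutions need not be unique.) A node of $u$ is a zero of $u$ that lies in the interior of the support of $u$ and at which $u$ changes sign, that is, $u>0$ immediately on one side of it and $u<0$ immediately on the other. Let $\lambda_0>0$. Then: 1. (The number of nodes changes locally by at most one.) There are $\delta>0$ and an integer $k\ge0$ such that for every $\lambda>0$ with $|\lambda-\lambda_0|<\delta$, every solution with initial value $\lambda$ has exactly $k$ or exactly $k+1$ nodes. 2. (The number of nodes changes only at compactly supported solutions.) If there are no $\delta>0$ and no integer $k\ge0$ such that, for every $\lambda>0$ with $|\lambda-\lambda_0|<\delta$, every solution with initial value $\lambda$ has exactly $k$ nodes, then there is a solution with initial value $\lambda_0$ that has compact support. -/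

import Mathlib

open Filter Topology Set MeasureTheory

namespace RadialPLaplace

/-- `φ_p(s) = |s|^(p-2) s`, with `φ_p(0) = 0`. -/
noncomputable def phi (p s : ℝ) : ℝ := |s| ^ (p - 2) * s

/-- The primitive `F(u) = ∫₀ᵘ f(s) ds`. -/
noncomputable def primitive (f : ℝ → ℝ) (u : ℝ) : ℝ := ∫ s in (0 : ℝ)..u, f s

/-- (H1): `f` is continuous, locally Lipschitz away from `0`, and `f(0) = 0`. -/
def H1 (f : ℝ → ℝ) : Prop :=
  Continuous f ∧ LocallyLipschitzOn {s : ℝ | s ≠ 0} f ∧ f 0 = 0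

/-- (H2): for some `b < 0 < a`, `f` is strictly decreasing on `(b, a)`, and `a` (resp. `b`) is a
local minimum (resp. local maximum) of `f`. -/
def H2 (f : ℝ → ℝ) : Prop :=
  ∃ a b : ℝ, 0 < a ∧ b < 0 ∧ StrictAntiOn f (Ioo b a) ∧ IsLocalMin f a ∧ IsLocalMax f b

/-- `u ↦ |F(x₀) - F(u)|^(-1/p)` is integrable on a neighbourhood of `x₀`. The power is taken in
`[0, ∞]`, so that it is `∞` where `F(u) = F(x₀)`. -/
def IntegrableNear (p : ℝ) (f : ℝ → ℝ) (x₀ : ℝ) : Prop :=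
  ∃ ε : ℝ, 0 < ε ∧
    ∫⁻ u in Ioo (x₀ - ε) (x₀ + ε),
      (ENNReal.ofReal |primitive f x₀ - primitive f u|) ^ (-(1 / p)) < ⊤

/-- (H3): `|F|^(-1/p)` is integrable near `0` (note `F(0) = 0`), and `|F(x₀) - F|^(-1/p)` is
integrable near every local maximum `x₀ ≠ 0` of `F`. -/
def H3 (p : ℝ) (f : ℝ → ℝ) : Prop :=
  IntegrableNear p f 0 ∧
    ∀ x₀ : ℝ, x₀ ≠ 0 → IsLocalMax (primitive f) x₀ → IntegrableNear p f x₀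

/-- (H4): `F < 0` at every nonzero zero of `f`. -/
def H4 (f : ℝ → ℝ) : Prop :=
  ∀ u₀ : ℝ, u₀ ≠ 0 → f u₀ = 0 → primitive f u₀ < 0

/-- (H5): `f` is nondecreasing for large values of `u`, and `f(u) / (|u|^(p-2) u) → ∞` as
`|u| → ∞`. -/
def H5 (p : ℝ) (f : ℝ → ℝ) : Prop :=
  (∃ M : ℝ, MonotoneOn f (Ici M)) ∧
    Tendsto (fun u : ℝ => f u / phi p u) (atBot ⊔ atTop) atTop

/-- The derivative of a function on `[0, ∞)` (one-sided at `0`). -/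
noncomputable def rderiv (u : ℝ → ℝ) (r : ℝ) : ℝ := derivWithin u (Ici 0) r

/-- `u` is a classical solution on `[0, ∞)` of
`(r^(N-1) φ_p(u'))' + r^(N-1) f(u) = 0` for `r > 0`, with `u(0) = lam` and `u'(0) = 0`.
Only the values of `u` on `[0, ∞)` are relevant. -/
structure IsSolution (N : ℕ) (p : ℝ) (f : ℝ → ℝ) (lam : ℝ) (u : ℝ → ℝ) : Prop where
  contDiffOn : ContDiffOn ℝ 1 u (Ici 0)
  contDiffOn_flux : ContDiffOn ℝ 1 (fun r => phi p (rderiv u r)) (Ioi 0)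
  equation : ∀ r : ℝ, 0 < r →
    deriv (fun s => s ^ (N - 1) * phi p (rderiv u s)) r + r ^ (N - 1) * f (u r) = 0
  initial_value : u 0 = lam
  initial_deriv : rderiv u 0 = 0

/-- The support of a function on `[0, ∞)`. -/
def radialSupport (u : ℝ → ℝ) : Set ℝ := closure {r : ℝ | 0 ≤ r ∧ u r ≠ 0}

/-- `u` changes sign at `r`. -/
def ChangesSignAt (u : ℝ → ℝ) (r : ℝ) : Prop :=
  ((∀ᶠ s in 𝓝[<] r, 0 < u s) ∧ (∀ᶠ s in 𝓝[>] r, u s < 0)) ∨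
    ((∀ᶠ s in 𝓝[<] r, u s < 0) ∧ (∀ᶠ s in 𝓝[>] r, 0 < u s))

/-- The nodes of `u`: the zeros in the interior of the support at which `u` changes sign. (The
point `r = 0` cannot be a node of a solution with `u(0) > 0`.) -/
def nodes (u : ℝ → ℝ) : Set ℝ :=
  {r : ℝ | 0 < r ∧ u r = 0 ∧ r ∈ interior (radialSupport u) ∧ ChangesSignAt u r}

end RadialPLaplace

/-!
Write `E = (p - 1)/p |u'|^p + F(u)` for the energy of a solution, so that `E' = -(N - 1)|u'|^p / r`.
At a zero of `u` one has `E ≥ 0`, so all nodes occur before the energy becomes negative, and a zero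
with `E > 0` is simple. The theorem follows from four facts.

* Every solution runs out of energy in finite time (`IsSolution.exists_energy_nonpos`). As
  `|F|^(-1/p)` is integrable at `0`, a solution of positive energy crosses a small well `|u| ≤ β` in
  bounded time (`IsWell.sub_le`). Outside the well (H4) forces a dissipation of order `1/r` per unit
  of time (`IsSolution.exists_drop`), and the harmonic series diverges.
* While `E > 0` the solution is determined by its initial value (`IsSolution.eq_of_energy_pos`).
  Where `u' ≠ 0`, the pair `(u, E)` solves a first-order system with `C¹` right-hand side, although
  `f` need not be Lipschitz at `0`. Where `u' = 0` and `E > 0`, one has `F(u) > 0`, so `f(u) ≠ 0` by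
  (H4), and a contraction argument applies, also at `r = 0`.
* Solutions with initial values near `lam₀` converge, along ultrafilters, in `C¹` on bounded
  intervals to a solution with initial value `lam₀` (`exists_limit_solution`), and simple zeros are stable
  under such convergence (`eventually_encard_zeros_eq`).
* A solution that is inside the half well with little energy has at most one more node, since
  leaving the well and coming back would cost a fixed amount of energy
  (`IsWell.exists_nodes_subsingleton`).

Let `u` have initial value `lam₀` and let `r₀` be the first time with `E ≤ 0`. If `u(r₀) ≠ 0`, then
`E < 0` after `r₀`, and all nearby solutions have as many nodes as `u` has zeros in `[0, r₀]`. If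
`u(r₀) = 0`, then `u'(r₀) = 0`. Nearby solutions then have the nodes of `u` before `r₀` and at most
one more, and extending `u` by `0` beyond `r₀` gives a compactly supported solution.
-/

namespace RadialPLaplace

/-! ### The function `φ_p` and the primitive `F` -/

lemma abs_phi {p : ℝ} (hp : 1 < p) (s : ℝ) : |phi p s| = |s| ^ (p - 1) := by
  unfold phi
  rcases eq_or_ne s 0 with rfl | hs
  · rw [mul_zero, abs_zero, Real.zero_rpow (by linarith)]
  · have h0 : 0 < |s| := abs_pos.mpr hs
    rw [abs_mul, abs_of_nonneg (Real.rpow_nonneg (abs_nonneg s) _)]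
    nth_rewrite 2 [← Real.rpow_one |s|]
    rw [← Real.rpow_add h0]
    congr 1; ring

lemma phi_zero (p : ℝ) : phi p 0 = 0 := by simp [phi]

lemma phi_mul_self {p : ℝ} (hp : 1 < p) (s : ℝ) : phi p s * s = |s| ^ p := by
  unfold phi
  rcases eq_or_ne s 0 with rfl | hs
  · rw [mul_zero, abs_zero, Real.zero_rpow (by linarith)]
  · have h0 : 0 < |s| := abs_pos.mpr hs
    have : |s| ^ (p - 2) * s * s = |s| ^ (p - 2) * |s| ^ (2 : ℝ) := by
      rw [Real.rpow_two, sq_abs]; ring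
    rw [this, ← Real.rpow_add h0]
    congr 1; ring

/-- `φ_p` and `φ_{p'}` are mutually inverse for the conjugate exponent `p' = p / (p - 1)`. -/
lemma phi_conj_phi {p : ℝ} (hp : 1 < p) (s : ℝ) : phi (p / (p - 1)) (phi p s) = s := by
  have hp1 : p - 1 ≠ 0 := by linarith
  have hab := abs_phi hp s
  rcases eq_or_ne s 0 with rfl | hs
  · simp [phi]
  · have h0 : 0 < |s| := abs_pos.mpr hs
    conv_lhs => unfold phi
    change |phi p s| ^ (p / (p - 1) - 2) * (|s| ^ (p - 2) * s) = s
    rw [hab, ← Real.rpow_mul h0.le, ← mul_assoc, ← Real.rpow_add h0]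
    have : (p - 1) * (p / (p - 1) - 2) + (p - 2) = 0 := by field_simp; ring
    rw [this, Real.rpow_zero, one_mul]

lemma one_lt_conj {p : ℝ} (hp : 1 < p) : 1 < p / (p - 1) := by
  rw [lt_div_iff₀ (by linarith)]; linarith

lemma hasDerivAt_abs_rpow_eq_phi {p : ℝ} (hp : 1 < p) (x : ℝ) :
    HasDerivAt (fun x : ℝ => |x| ^ p) (p * phi p x) x := by
  have := hasDerivAt_abs_rpow x hp
  rwa [mul_assoc] at this

lemma continuous_phi {p : ℝ} (hp : 1 < p) : Continuous (phi p) := by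
  have h1 : ContDiff ℝ 1 (fun x : ℝ => ‖x‖ ^ p) := contDiff_norm_rpow hp
  have h2 : Continuous (deriv (fun x : ℝ => ‖x‖ ^ p)) := (contDiff_one_iff_deriv.mp h1).2
  have h3 : deriv (fun x : ℝ => ‖x‖ ^ p) = fun x => p * phi p x := by
    ext x; exact (hasDerivAt_abs_rpow_eq_phi hp x).deriv
  rw [h3] at h2
  have h4 : phi p = fun x => p⁻¹ * (p * phi p x) := by
    ext x; rw [← mul_assoc, inv_mul_cancel₀ (by linarith), one_mul]
  rw [h4]; exact continuous_const.mul h2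

lemma contDiffAt_phi (p : ℝ) {x : ℝ} (hx : x ≠ 0) : ContDiffAt ℝ 1 (phi p) x := by
  unfold phi
  exact ((contDiffAt_abs hx).rpow_const_of_ne (abs_ne_zero.mpr hx)).mul contDiffAt_id

lemma phi_mul (q b x : ℝ) : phi q (b * x) = phi q b * phi q x := by
  unfold phi
  rw [abs_mul, Real.mul_rpow (abs_nonneg _) (abs_nonneg _)]; ring

lemma hasDerivAt_primitive {f : ℝ → ℝ} (hf : Continuous f) (x : ℝ) :
    HasDerivAt (primitive f) (f x) x :=
  intervalIntegral.integral_hasDerivAt_right (hf.intervalIntegrable _ _)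
    (hf.stronglyMeasurableAtFilter _ _) hf.continuousAt

lemma continuous_primitive {f : ℝ → ℝ} (hf : Continuous f) : Continuous (primitive f) :=
  continuous_iff_continuousAt.mpr fun x => (hasDerivAt_primitive hf x).continuousAt

lemma contDiff_primitive {f : ℝ → ℝ} (hf : Continuous f) : ContDiff ℝ 1 (primitive f) := by
  rw [contDiff_one_iff_deriv]
  refine ⟨fun x => (hasDerivAt_primitive hf x).differentiableAt, ?_⟩
  rwa [show deriv (primitive f) = f from funext fun x => (hasDerivAt_primitive hf x).deriv]

lemma primitive_zero (f : ℝ → ℝ) : primitive f 0 = 0 := by simp [primitive]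

/-! ### Solutions, their flux and their energy -/

section Solution

variable {N : ℕ} {p : ℝ} {f : ℝ → ℝ} {lam : ℝ} {u : ℝ → ℝ}

lemma rderiv_eq_of_hasDerivAt {r d : ℝ} (hr : 0 ≤ r) (h : HasDerivWithinAt u d (Ici 0) r) :
    rderiv u r = d :=
  h.derivWithin (uniqueDiffOn_Ici 0 r hr)

lemma IsSolution.continuousOn (h : IsSolution N p f lam u) : ContinuousOn u (Ici 0) :=
  h.contDiffOn.continuousOn

lemma IsSolution.continuousOn_rderiv (h : IsSolution N p f lam u) :
    ContinuousOn (rderiv u) (Ici 0) :=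
  ((contDiffOn_one_iff_derivWithin (uniqueDiffOn_Ici 0)).mp h.contDiffOn).2

lemma IsSolution.hasDerivWithinAt (h : IsSolution N p f lam u) {r : ℝ} (hr : 0 ≤ r) :
    HasDerivWithinAt u (rderiv u r) (Ici 0) r :=
  (((contDiffOn_one_iff_derivWithin (uniqueDiffOn_Ici 0)).mp h.contDiffOn).1 r hr).hasDerivWithinAt

lemma IsSolution.hasDerivAt (h : IsSolution N p f lam u) {r : ℝ} (hr : 0 < r) :
    HasDerivAt u (rderiv u r) r :=
  (h.hasDerivWithinAt hr.le).hasDerivAt (Ici_mem_nhds hr)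

lemma IsSolution.hasDerivAt_flux (h : IsSolution N p f lam u) {r : ℝ} (hr : 0 < r) :
    HasDerivAt (fun s => s ^ (N - 1) * phi p (rderiv u s)) (-(r ^ (N - 1) * f (u r))) r := by
  have h1 : DifferentiableAt ℝ (fun r => phi p (rderiv u r)) r :=
    (h.contDiffOn_flux.differentiableOn one_ne_zero r hr).differentiableAt (Ioi_mem_nhds hr)
  have h2 : DifferentiableAt ℝ (fun s => s ^ (N - 1) * phi p (rderiv u s)) r :=
    (differentiableAt_id.pow _).mul h1
  have h3 := h2.hasDerivAt
  rwa [eq_neg_of_add_eq_zero_left (h.equation r hr)] at h3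

/-- The equation in the form `P' = -f(u) - (N - 1) P / r` for `P = φ_p(u')`. -/
lemma hasDerivAt_phi_of_flux {d : ℝ → ℝ} {g r : ℝ} (hr : 0 < r)
    (h : HasDerivAt (fun s => s ^ (N - 1) * d s) (-(r ^ (N - 1) * g)) r) :
    HasDerivAt d (-g - ((N - 1 : ℕ) : ℝ) / r * d r) r := by
  have h1 : HasDerivAt (fun s : ℝ => (s ^ (N - 1))⁻¹ * (s ^ (N - 1) * d s))
      (-(((N - 1 : ℕ) : ℝ) * r ^ (N - 1 - 1)) / (r ^ (N - 1)) ^ 2 * (r ^ (N - 1) * d r)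
        + (r ^ (N - 1))⁻¹ * (-(r ^ (N - 1) * g))) r :=
    ((hasDerivAt_pow (N - 1) r).inv (by positivity)).mul h
  have h2 : (fun s : ℝ => (s ^ (N - 1))⁻¹ * (s ^ (N - 1) * d s)) =ᶠ[𝓝 r] d := by
    filter_upwards [Ioi_mem_nhds hr] with s hs
    have : s ^ (N - 1) ≠ 0 := pow_ne_zero _ (ne_of_gt hs)
    field_simp
  have h3 := h1.congr_of_eventuallyEq h2.symm
  refine h3.congr_deriv ?_
  rcases Nat.eq_zero_or_pos (N - 1) with h0 | h0
  · rw [h0]; simp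
  · obtain ⟨m, hm⟩ : ∃ m, N - 1 = m + 1 := ⟨N - 1 - 1, by omega⟩
    rw [hm]
    simp only [Nat.add_sub_cancel]
    field_simp
    ring

lemma IsSolution.hasDerivAt_phi (h : IsSolution N p f lam u) {r : ℝ} (hr : 0 < r) :
    HasDerivAt (fun s => phi p (rderiv u s))
      (-f (u r) - ((N - 1 : ℕ) : ℝ) / r * phi p (rderiv u r)) r :=
  hasDerivAt_phi_of_flux hr (h.hasDerivAt_flux hr)

/-- A criterion for being a solution in terms of a candidate `d` for the derivative. -/
lemma IsSolution.of_hasDerivAt {d : ℝ → ℝ} (hp : 1 < p) (hf : Continuous f)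
    (hu0 : ContinuousWithinAt u (Ici 0) 0) (hd : ContinuousOn d (Ici 0))
    (hud : ∀ r, 0 < r → HasDerivAt u (d r) r)
    (hflux : ∀ r, 0 < r → HasDerivAt (fun s => s ^ (N - 1) * phi p (d s))
      (-(r ^ (N - 1) * f (u r))) r) (h0 : u 0 = lam) (hd0 : d 0 = 0) :
    IsSolution N p f lam u ∧ ∀ r, 0 ≤ r → rderiv u r = d r := by
  have hcu : ContinuousOn u (Ici 0) := by
    intro r hr
    rcases eq_or_lt_of_le (show (0 : ℝ) ≤ r from hr) with rfl | hr'
    · exact hu0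
    · exact (hud r hr').continuousAt.continuousWithinAt
  have hw : ∀ r, 0 ≤ r → HasDerivWithinAt u (d r) (Ici 0) r := by
    intro r hr
    rcases eq_or_lt_of_le hr with rfl | hr'
    · refine hasDerivWithinAt_Ici_of_tendsto_deriv (s := Ioi 0)
        (fun x hx => (hud x hx).differentiableAt.differentiableWithinAt)
        (hu0.mono Ioi_subset_Ici_self) self_mem_nhdsWithin ?_
      have h1 : Tendsto d (𝓝[>] 0) (𝓝 (d 0)) :=
        (hd 0 self_mem_Ici).mono_left (nhdsWithin_mono _ Ioi_subset_Ici_self)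
      refine h1.congr' ?_
      filter_upwards [self_mem_nhdsWithin] with x hx
      exact (hud x hx).deriv.symm
    · exact (hud r hr').hasDerivWithinAt
  have hrd : ∀ r, 0 ≤ r → rderiv u r = d r := fun r hr => rderiv_eq_of_hasDerivAt hr (hw r hr)
  have hfl : ∀ r, 0 < r → HasDerivAt (fun s => s ^ (N - 1) * phi p (rderiv u s))
      (-(r ^ (N - 1) * f (u r))) r := by
    intro r hr
    refine (hflux r hr).congr_of_eventuallyEq ?_
    filter_upwards [Ioi_mem_nhds hr] with s hs
    rw [hrd s (le_of_lt hs)]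
  have hrc : ContinuousOn (rderiv u) (Ici 0) := hd.congr fun r hr => hrd r hr
  refine ⟨⟨?_, ?_, ?_, h0, ?_⟩, hrd⟩
  · rw [contDiffOn_one_iff_derivWithin (uniqueDiffOn_Ici 0)]
    exact ⟨fun r hr => (hw r hr).differentiableWithinAt, hrc⟩
  · have hP : ∀ r, 0 < r → HasDerivAt (fun s => phi p (rderiv u s))
        (-f (u r) - ((N - 1 : ℕ) : ℝ) / r * phi p (rderiv u r)) r :=
      fun r hr => hasDerivAt_phi_of_flux hr (hfl r hr)
    rw [contDiffOn_one_iff_derivWithin (uniqueDiffOn_Ioi 0)]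
    refine ⟨fun r hr => (hP r hr).differentiableAt.differentiableWithinAt, ?_⟩
    have hc : ContinuousOn
        (fun r => -f (u r) - ((N - 1 : ℕ) : ℝ) / r * phi p (rderiv u r)) (Ioi 0) := by
      refine ContinuousOn.sub ?_ (ContinuousOn.mul ?_ ?_)
      · exact (hf.comp_continuousOn (hcu.mono Ioi_subset_Ici_self)).neg
      · exact continuousOn_const.div continuousOn_id fun r hr => ne_of_gt hr
      · exact (continuous_phi hp).comp_continuousOn (hrc.mono Ioi_subset_Ici_self)
    exact hc.congr fun r hr =>
      (hP r hr).hasDerivWithinAt.derivWithin (uniqueDiffOn_Ioi 0 r hr)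
  · intro r hr
    rw [(hfl r hr).deriv]; ring
  · rw [hrd 0 le_rfl, hd0]

/-- The energy `(p - 1)/p |u'|^p + F(u)`, which is nonincreasing along a solution. -/
noncomputable def energy (p : ℝ) (f u : ℝ → ℝ) (r : ℝ) : ℝ :=
  (p - 1) / p * |rderiv u r| ^ p + primitive f (u r)

lemma IsSolution.energy_zero (hp : 1 < p) (h : IsSolution N p f lam u) :
    energy p f u 0 = primitive f lam := by
  simp [energy, h.initial_deriv, h.initial_value, Real.zero_rpow (by linarith : p ≠ 0)]

lemma primitive_le_energy (hp : 1 < p) (r : ℝ) : primitive f (u r) ≤ energy p f u r := by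
  have : 0 ≤ (p - 1) / p * |rderiv u r| ^ p :=
    mul_nonneg (div_nonneg (by linarith) (by linarith)) (Real.rpow_nonneg (abs_nonneg _) _)
  unfold energy; linarith

lemma abs_rderiv_rpow (hp : 1 < p) (r : ℝ) :
    |rderiv u r| ^ p = p / (p - 1) * (energy p f u r - primitive f (u r)) := by
  have h1 : p - 1 ≠ 0 := by linarith
  have h2 : p ≠ 0 := by linarith
  unfold energy; field_simp; ring

lemma le_abs_rderiv_rpow (hp : 1 < p) (r : ℝ) :
    energy p f u r - primitive f (u r) ≤ |rderiv u r| ^ p := by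
  rw [abs_rderiv_rpow (f := f) hp]
  have h1 := primitive_le_energy (f := f) (u := u) hp r
  nlinarith [one_lt_conj hp]

lemma IsSolution.continuousOn_energy (hp : 1 < p) (hf : Continuous f)
    (h : IsSolution N p f lam u) : ContinuousOn (energy p f u) (Ici 0) := by
  refine ContinuousOn.add (ContinuousOn.mul continuousOn_const ?_) ?_
  · exact (h.continuousOn_rderiv.abs).rpow_const fun _ _ => Or.inr (by linarith)
  · exact (continuous_primitive hf).comp_continuousOn h.continuousOn

lemma IsSolution.hasDerivAt_energy (hp : 1 < p) (hf : Continuous f)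
    (h : IsSolution N p f lam u) {r : ℝ} (hr : 0 < r) :
    HasDerivAt (energy p f u) (-(((N - 1 : ℕ) : ℝ) / r * |rderiv u r| ^ p)) r := by
  have hp1 : p - 1 ≠ 0 := by linarith
  have hp0 : p ≠ 0 := by linarith
  -- `|u'|^p = |φ_p(u')|^{p'}`, and `φ_p(u')` is differentiable although `u'` need not be.
  have h1 : ∀ s, |rderiv u s| ^ p = |phi p (rderiv u s)| ^ (p / (p - 1)) := by
    intro s
    rw [abs_phi hp, ← Real.rpow_mul (abs_nonneg _)]
    congr 1; field_simp
  have h2 := (hasDerivAt_abs_rpow_eq_phi (one_lt_conj hp) (phi p (rderiv u r))).comp r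
    (h.hasDerivAt_phi hr)
  have h3 := (hasDerivAt_primitive hf (u r)).comp r (h.hasDerivAt hr)
  have h4 := (h2.const_mul ((p - 1) / p)).add h3
  rw [phi_conj_phi hp] at h4
  have h5 : energy p f u = fun s => (p - 1) / p * ((fun x => |x| ^ (p / (p - 1))) ∘
      fun s => phi p (rderiv u s)) s + (primitive f ∘ u) s := by
    ext s; simp only [energy, Function.comp, h1]
  rw [h5]
  refine HasDerivAt.congr_deriv h4 ?_
  rw [← phi_mul_self hp]
  field_simp
  ring

lemma IsSolution.antitoneOn_energy (hp : 1 < p) (hf : Continuous f)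
    (h : IsSolution N p f lam u) : AntitoneOn (energy p f u) (Ici 0) := by
  refine antitoneOn_of_hasDerivWithinAt_nonpos (convex_Ici 0) (h.continuousOn_energy hp hf)
    (f' := fun r => -(((N - 1 : ℕ) : ℝ) / r * |rderiv u r| ^ p)) ?_ ?_
  · intro r hr
    rw [interior_Ici] at hr
    exact (h.hasDerivAt_energy hp hf hr).hasDerivWithinAt
  · intro r hr
    rw [interior_Ici] at hr
    have : 0 ≤ ((N - 1 : ℕ) : ℝ) / r * |rderiv u r| ^ p :=
      mul_nonneg (div_nonneg (Nat.cast_nonneg _) (le_of_lt hr))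
        (Real.rpow_nonneg (abs_nonneg _) _)
    linarith

end Solution

/-! ### The potential well of `F` at `0` and coercivity of `F` -/

/-- `β` measures a well of `F` at `0`: `F < 0` on the punctured interval `0 < |x| ≤ 2β`, and
`|F|^(-1/p)` is integrable over `[-2β, 2β]`. The factor `2` leaves room around `[-β, β]`. -/
structure IsWell (p : ℝ) (f : ℝ → ℝ) (β : ℝ) : Prop where
  pos : 0 < β
  neg : ∀ x, x ≠ 0 → |x| ≤ 2 * β → primitive f x < 0
  integrable : IntegrableOn (fun x => |primitive f x| ^ (-(1 / p))) (Icc (-(2 * β)) (2 * β))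

lemma H2.exists_primitive_neg {f : ℝ → ℝ} (hf : Continuous f) (hf0 : f 0 = 0) (h2 : H2 f) :
    ∃ γ, 0 < γ ∧ ∀ x, x ≠ 0 → |x| < γ → primitive f x < 0 := by
  obtain ⟨a, b, ha, hb, hanti, -, -⟩ := h2
  refine ⟨min a (-b), lt_min ha (neg_pos.mpr hb), fun x hx0 hx => ?_⟩
  obtain ⟨hxa, hxb⟩ := lt_min_iff.mp hx
  have h0 : (0 : ℝ) ∈ Ioo b a := ⟨hb, ha⟩
  rcases lt_or_gt_of_ne hx0 with hneg | hpos
  · rw [abs_of_neg hneg] at hxa hxb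
    obtain ⟨c, hc, hce⟩ := exists_hasDerivAt_eq_slope (primitive f) f hneg
      (continuous_primitive hf).continuousOn fun y _ => hasDerivAt_primitive hf y
    have hfc : f 0 < f c := hanti ⟨by linarith [hc.1], by linarith [hc.2]⟩ h0 hc.2
    rw [hce, hf0, primitive_zero, zero_sub, zero_sub] at hfc
    have := (div_pos_iff_of_pos_right (by linarith)).mp hfc
    linarith
  · rw [abs_of_pos hpos] at hxa hxb
    obtain ⟨c, hc, hce⟩ := exists_hasDerivAt_eq_slope (primitive f) f hpos
      (continuous_primitive hf).continuousOn fun y _ => hasDerivAt_primitive hf y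
    have hfc : f c < f 0 := hanti h0 ⟨by linarith [hc.1], by linarith [hc.2]⟩ hc.1
    rw [hce, hf0, primitive_zero, sub_zero, sub_zero] at hfc
    exact (div_neg_iff.mp hfc).elim (fun h => absurd h.2 (by linarith)) (fun h => h.1)

lemma measurable_abs_primitive_rpow {f : ℝ → ℝ} (hf : Continuous f) (c : ℝ) :
    Measurable fun x => |primitive f x| ^ c :=
  (continuous_primitive hf).abs.measurable.pow_const _

lemma exists_isWell {p : ℝ} {f : ℝ → ℝ} (h1 : H1 f) (h2 : H2 f)
    (h3 : IntegrableNear p f 0) : ∃ β, IsWell p f β := by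
  obtain ⟨γ, hγ, hneg⟩ := h2.exists_primitive_neg h1.1 h1.2.2
  obtain ⟨ε, hε, hint⟩ := h3
  have hm : 0 < min γ ε := lt_min hγ hε
  have hmγ := min_le_left γ ε
  have hmε := min_le_right γ ε
  refine ⟨min γ ε / 3, by positivity, fun x hx hxb => hneg x hx (by linarith), ?_⟩
  refine ⟨(measurable_abs_primitive_rpow h1.1 _).aestronglyMeasurable, ?_⟩
  refine lt_of_le_of_lt ?_ hint
  refine (lintegral_mono_set (t := Ioo (0 - ε) (0 + ε)) ?_).trans ?_
  · intro x hx
    exact ⟨by linarith [hx.1], by linarith [hx.2]⟩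
  · refine lintegral_mono fun x => ?_
    rw [Real.enorm_of_nonneg (Real.rpow_nonneg (abs_nonneg _) _), primitive_zero, zero_sub,
      abs_neg]
    rcases eq_or_lt_of_le (abs_nonneg (primitive f x)) with h0 | h0
    · -- The two conventions for negative powers of `0` differ, in the harmless direction.
      rw [← h0, ENNReal.ofReal_zero]
      rcases eq_or_ne p 0 with rfl | hp
      · simp
      · rw [Real.zero_rpow (by simpa using hp), ENNReal.ofReal_zero]
        exact zero_le
    · rw [ENNReal.ofReal_rpow_of_pos h0]

lemma eventually_le_of_H5 {p : ℝ} (hp : 1 < p) {f : ℝ → ℝ} (h5 : H5 p f) :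
    ∃ M : ℝ, 0 < M ∧ (∀ x, M ≤ x → 1 ≤ f x) ∧ ∀ x, x ≤ -M → f x ≤ -1 := by
  have h := h5.2
  rw [tendsto_sup] at h
  obtain ⟨A, hA⟩ := eventually_atBot.mp (h.1.eventually_ge_atTop 1)
  obtain ⟨B, hB⟩ := eventually_atTop.mp (h.2.eventually_ge_atTop 1)
  have key : ∀ y : ℝ, 1 ≤ y → 1 ≤ y ^ (p - 2) * y := by
    intro y hy
    have h1 := abs_phi hp y
    rw [abs_of_nonneg (by linarith : 0 ≤ y)] at h1
    unfold phi at h1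
    rw [abs_of_nonneg (by linarith : 0 ≤ y)] at h1
    rw [← abs_of_nonneg (mul_nonneg (Real.rpow_nonneg (by linarith) _) (by linarith : 0 ≤ y)), h1]
    exact Real.one_le_rpow hy (by linarith)
  refine ⟨max 1 (max (-A) B), by positivity, fun x hx => ?_, fun x hx => ?_⟩
  · have hx1 : 1 ≤ x := (le_max_left _ _).trans hx
    have hxB : B ≤ x := ((le_max_right _ _).trans (le_max_right _ _)).trans hx
    have h1 := hB x hxB
    have hk := key x hx1
    unfold phi at h1
    rw [abs_of_nonneg (by linarith : 0 ≤ x), le_div_iff₀ (by linarith)] at h1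
    linarith
  · have hx1 : 1 ≤ -x := (le_max_left _ _).trans (by linarith)
    have hxA : -A ≤ -x := ((le_max_left _ _).trans (le_max_right _ _)).trans (by linarith)
    have h1 := hA x (by linarith)
    have hk := key (-x) hx1
    unfold phi at h1
    rw [abs_of_nonpos (by linarith : x ≤ 0), le_div_iff_of_neg (by linarith)] at h1
    linarith

lemma exists_bound_of_primitive_le {p : ℝ} (hp : 1 < p) {f : ℝ → ℝ} (hf : Continuous f)
    (h5 : H5 p f) (C : ℝ) : ∃ U, 0 < U ∧ ∀ x, primitive f x ≤ C → |x| ≤ U := by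
  obtain ⟨M, hM, hpos, hneg⟩ := eventually_le_of_H5 hp h5
  have hR : ∀ x, M < x → primitive f M + (x - M) ≤ primitive f x := by
    intro x hx
    obtain ⟨c, hc, hce⟩ := exists_hasDerivAt_eq_slope (primitive f) f hx
      (continuous_primitive hf).continuousOn fun y _ => hasDerivAt_primitive hf y
    have := hpos c hc.1.le
    rw [hce, le_div_iff₀ (by linarith)] at this
    linarith
  have hL : ∀ x, x < -M → primitive f (-M) + (-M - x) ≤ primitive f x := by
    intro x hx
    obtain ⟨c, hc, hce⟩ := exists_hasDerivAt_eq_slope (primitive f) f hx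
      (continuous_primitive hf).continuousOn fun y _ => hasDerivAt_primitive hf y
    have := hneg c hc.2.le
    rw [hce, div_le_iff₀ (by linarith)] at this
    linarith
  have hB1 := abs_nonneg (C - primitive f M)
  have hB2 := abs_nonneg (C - primitive f (-M))
  have hB3 := le_abs_self (C - primitive f M)
  have hB4 := le_abs_self (C - primitive f (-M))
  refine ⟨M + |C - primitive f M| + |C - primitive f (-M)|, by positivity, fun x hx => ?_⟩
  rw [abs_le]
  constructor
  · by_contra hcon
    have := hL x (by linarith)
    linarith
  · by_contra hcon
    have := hR x (by linarith)
    linarith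

/-! ### Passing through the well takes bounded time -/

/-- Half of an upper bound for the time that a solution of positive energy can spend in `[-β, β]`
without leaving it; see `IsWell.sub_le`. -/
noncomputable def transitTime (p : ℝ) (f : ℝ → ℝ) (β : ℝ) : ℝ :=
  ∫ x in Icc (-(2 * β)) (2 * β), |primitive f x| ^ (-(1 / p))

lemma transitTime_nonneg (p : ℝ) (f : ℝ → ℝ) (β : ℝ) : 0 ≤ transitTime p f β :=
  setIntegral_nonneg measurableSet_Icc fun _ _ => Real.rpow_nonneg (abs_nonneg _) _

section Transit

variable {p : ℝ} {f : ℝ → ℝ} {β : ℝ} {u d : ℝ → ℝ} {t₁ t₂ : ℝ}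

/-- With `G' = |F|^(-1/p)`, the function `G ∘ u` has slope at least `1` in absolute value, while
`G` oscillates by at most `transitTime p f β`. -/
lemma IsWell.sub_le_of_ne_zero (hp : 1 < p) (hf : Continuous f) (hw : IsWell p f β)
    (h12 : t₁ ≤ t₂) (hu : ContinuousOn u (Icc t₁ t₂))
    (hd : ∀ r ∈ Ioo t₁ t₂, HasDerivAt u (d r) r) (hβ : ∀ r ∈ Icc t₁ t₂, |u r| ≤ β)
    (hE : ∀ r ∈ Ioo t₁ t₂, -primitive f (u r) ≤ |d r| ^ p) (hne : ∀ r ∈ Ioo t₁ t₂, u r ≠ 0) :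
    t₂ - t₁ ≤ transitTime p f β := by
  rcases eq_or_lt_of_le h12 with rfl | hlt
  · rw [sub_self]; exact transitTime_nonneg p f β
  have hβ0 := hw.pos
  have hmem : ∀ x, |x| ≤ β → x ∈ Icc (-(2 * β)) (2 * β) := fun x hx => by
    rw [abs_le] at hx; exact ⟨by linarith [hx.1], by linarith [hx.2]⟩
  have hII : ∀ x ∈ Icc (-(2 * β)) (2 * β), ∀ y ∈ Icc (-(2 * β)) (2 * β),
      IntervalIntegrable (fun x => |primitive f x| ^ (-(1 / p))) volume x y := fun x hx y hy =>
    (hw.integrable.mono_set (ordConnected_Icc.uIcc_subset hx hy)).intervalIntegrable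
  have h0mem : (0 : ℝ) ∈ Icc (-(2 * β)) (2 * β) := hmem 0 (by simpa using hβ0.le)
  set G : ℝ → ℝ := fun x => ∫ y in (0 : ℝ)..x, |primitive f y| ^ (-(1 / p)) with hG
  have hGc : ContinuousOn G (Icc (-(2 * β)) (2 * β)) := by
    have h := intervalIntegral.continuousOn_primitive_interval' (a := 0)
      (hII (-(2 * β)) ⟨le_rfl, by linarith⟩ (2 * β) ⟨by linarith, le_rfl⟩)
      (by rw [uIcc_of_le (by linarith)]; exact h0mem)
    rwa [uIcc_of_le (by linarith)] at h
  have hGd : ∀ x, x ≠ 0 → |x| ≤ β → HasDerivAt G (|primitive f x| ^ (-(1 / p))) x := by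
    intro x hx0 hx
    refine intervalIntegral.integral_hasDerivAt_right (hII 0 h0mem x (hmem x hx))
      ((measurable_abs_primitive_rpow hf _).stronglyMeasurable.stronglyMeasurableAtFilter) ?_
    refine (continuous_primitive hf).abs.continuousAt.rpow_const (Or.inl ?_)
    exact abs_ne_zero.mpr (hw.neg x hx0 (by linarith)).ne
  have hGT : ∀ x y, |x| ≤ β → |y| ≤ β → |G x - G y| ≤ transitTime p f β := by
    intro x y hx hy
    rw [hG]
    simp only
    rw [intervalIntegral.integral_interval_sub_left (hII 0 h0mem x (hmem x hx))
      (hII 0 h0mem y (hmem y hy))]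
    rw [← Real.norm_eq_abs]
    refine (intervalIntegral.norm_integral_le_integral_norm_uIoc).trans ?_
    simp only [Real.norm_of_nonneg (Real.rpow_nonneg (abs_nonneg (primitive f _)) _)]
    exact setIntegral_mono_set hw.integrable
      (Eventually.of_forall fun z => Real.rpow_nonneg (abs_nonneg _) _)
      ((uIoc_subset_uIcc.trans
        (ordConnected_Icc.uIcc_subset (hmem y hy) (hmem x hx))).eventuallyLE)
  obtain ⟨c, hc, hce⟩ := exists_hasDerivAt_eq_slope (G ∘ u)
    (fun r => |primitive f (u r)| ^ (-(1 / p)) * d r) hlt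
    (hGc.comp hu fun r hr => hmem _ (hβ r hr))
    (fun r hr => (hGd (u r) (hne r hr) (hβ r (Ioo_subset_Icc_self hr))).comp r (hd r hr))
  have hFneg := hw.neg (u c) (hne c hc) ((hβ c (Ioo_subset_Icc_self hc)).trans (by linarith))
  have h1 : 1 ≤ |(|primitive f (u c)| ^ (-(1 / p)) * d c)| := by
    have hFpos : 0 < |primitive f (u c)| := abs_pos.mpr hFneg.ne
    rw [abs_mul, abs_of_nonneg (Real.rpow_nonneg (abs_nonneg _) _), Real.rpow_neg hFpos.le,
      ← div_eq_inv_mul, le_div_iff₀ (Real.rpow_pos_of_pos hFpos _), one_mul]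
    have h2 := hE c hc
    rw [← abs_of_neg hFneg] at h2
    calc |primitive f (u c)| ^ (1 / p) ≤ (|d c| ^ p) ^ (1 / p) :=
          Real.rpow_le_rpow hFpos.le h2 (by positivity)
      _ = |d c| := by
          rw [← Real.rpow_mul (abs_nonneg _), mul_one_div_cancel (by linarith), Real.rpow_one]
  rw [hce, abs_div, abs_of_pos (by linarith : 0 < t₂ - t₁), le_div_iff₀ (by linarith),
    one_mul] at h1
  exact h1.trans (hGT _ _ (hβ _ (right_mem_Icc.mpr h12)) (hβ _ (left_mem_Icc.mpr h12)))

lemma injOn_of_deriv_ne_zero (hu : ContinuousOn u (Icc t₁ t₂))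
    (hd : ∀ r ∈ Ioo t₁ t₂, HasDerivAt u (d r) r) (hne : ∀ r ∈ Ioo t₁ t₂, d r ≠ 0) :
    InjOn u (Icc t₁ t₂) := by
  have key : ∀ x ∈ Icc t₁ t₂, ∀ y ∈ Icc t₁ t₂, x < y → u x ≠ u y := by
    intro x hx y hy hxy he
    have hsub : Ioo x y ⊆ Ioo t₁ t₂ := Ioo_subset_Ioo hx.1 hy.2
    obtain ⟨c, hc, hc0⟩ := exists_hasDerivAt_eq_zero hxy
      (hu.mono (Icc_subset_Icc hx.1 hy.2)) he fun r hr => hd r (hsub hr)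
    exact hne c (hsub hc) hc0
  intro x hx y hy he
  rcases lt_trichotomy x y with h | h | h
  · exact absurd he (key x hx y hy h)
  · exact h
  · exact absurd he.symm (key y hy x hx h)

lemma IsWell.sub_le (hp : 1 < p) (hf : Continuous f) (hw : IsWell p f β)
    (h12 : t₁ ≤ t₂) (hu : ContinuousOn u (Icc t₁ t₂))
    (hd : ∀ r ∈ Ioo t₁ t₂, HasDerivAt u (d r) r) (hβ : ∀ r ∈ Icc t₁ t₂, |u r| ≤ β)
    (hE : ∀ r ∈ Ioo t₁ t₂, -primitive f (u r) ≤ |d r| ^ p) (hne : ∀ r ∈ Ioo t₁ t₂, d r ≠ 0) :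
    t₂ - t₁ ≤ 2 * transitTime p f β := by
  have hT := transitTime_nonneg p f β
  have hinj := injOn_of_deriv_ne_zero hu hd hne
  by_cases hz : ∃ z ∈ Ioo t₁ t₂, u z = 0
  · obtain ⟨z, hz, hz0⟩ := hz
    have hzI := Ioo_subset_Icc_self hz
    have h1 : z - t₁ ≤ transitTime p f β := by
      refine hw.sub_le_of_ne_zero hp hf hz.1.le (hu.mono (Icc_subset_Icc_right hz.2.le))
        (fun r hr => hd r (Ioo_subset_Ioo_right hz.2.le hr))
        (fun r hr => hβ r (Icc_subset_Icc_right hz.2.le hr))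
        (fun r hr => hE r (Ioo_subset_Ioo_right hz.2.le hr)) fun r hr h0 => ?_
      have := hinj ⟨hr.1.le, hr.2.le.trans hz.2.le⟩ hzI (h0.trans hz0.symm)
      exact hr.2.ne this
    have h2 : t₂ - z ≤ transitTime p f β := by
      refine hw.sub_le_of_ne_zero hp hf hz.2.le (hu.mono (Icc_subset_Icc_left hz.1.le))
        (fun r hr => hd r (Ioo_subset_Ioo_left hz.1.le hr))
        (fun r hr => hβ r (Icc_subset_Icc_left hz.1.le hr))
        (fun r hr => hE r (Ioo_subset_Ioo_left hz.1.le hr)) fun r hr h0 => ?_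
      have := hinj ⟨hz.1.le.trans hr.1.le, hr.2.le⟩ hzI (h0.trans hz0.symm)
      exact hr.1.ne' this
    linarith
  · push Not at hz
    linarith [hw.sub_le_of_ne_zero hp hf h12 hu hd hβ hE hz]

end Transit

section SolutionTransit

variable {N : ℕ} {p : ℝ} {f : ℝ → ℝ} {lam : ℝ} {u : ℝ → ℝ} {β : ℝ}

lemma IsWell.primitive_nonpos (hw : IsWell p f β) {x : ℝ} (hx : |x| ≤ β) :
    primitive f x ≤ 0 := by
  rcases eq_or_ne x 0 with rfl | h0
  · exact (primitive_zero f).le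
  · exact (hw.neg x h0 (by linarith [hw.pos])).le

lemma rderiv_ne_zero_of_primitive_lt (hp : 1 < p) {r : ℝ}
    (h : primitive f (u r) < energy p f u r) : rderiv u r ≠ 0 := by
  intro h0
  simp [energy, h0, Real.zero_rpow (by linarith : p ≠ 0)] at h

lemma IsSolution.injOn_well (hp : 1 < p) (hw : IsWell p f β)
    (h : IsSolution N p f lam u) {t₁ t₂ : ℝ} (h1 : 0 ≤ t₁) (hβ : ∀ r ∈ Icc t₁ t₂, |u r| ≤ β)
    (hE : ∀ r ∈ Ioo t₁ t₂, 0 < energy p f u r) : InjOn u (Icc t₁ t₂) :=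
  injOn_of_deriv_ne_zero (h.continuousOn.mono fun _ hr => h1.trans hr.1)
    (fun _ hr => h.hasDerivAt (h1.trans_lt hr.1)) fun r hr =>
    rderiv_ne_zero_of_primitive_lt hp
      ((hw.primitive_nonpos (hβ r (Ioo_subset_Icc_self hr))).trans_lt (hE r hr))

lemma IsSolution.sub_le_well (hp : 1 < p) (hf : Continuous f) (hw : IsWell p f β)
    (h : IsSolution N p f lam u) {t₁ t₂ : ℝ} (h1 : 0 ≤ t₁) (h12 : t₁ ≤ t₂)
    (hβ : ∀ r ∈ Icc t₁ t₂, |u r| ≤ β) (hE : ∀ r ∈ Ioo t₁ t₂, 0 < energy p f u r) :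
    t₂ - t₁ ≤ 2 * transitTime p f β :=
  hw.sub_le hp hf h12 (h.continuousOn.mono fun _ hr => h1.trans hr.1)
    (fun _ hr => h.hasDerivAt (h1.trans_lt hr.1)) hβ
    (fun r hr => by
      have h2 := le_abs_rderiv_rpow (f := f) (u := u) hp r
      have h3 := hE r hr
      linarith)
    fun r hr => rderiv_ne_zero_of_primitive_lt hp
      ((hw.primitive_nonpos (hβ r (Ioo_subset_Icc_self hr))).trans_lt (hE r hr))

/-- Along an interval of constant energy a solution is constant, because `E' = -(N-1)|u'|^p / r`. -/
lemma IsSolution.rderiv_eq_zero_of_energy_eq (hp : 1 < p) (hN : p < N) (hf : Continuous f)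
    (h : IsSolution N p f lam u) {t₁ t₂ : ℝ} (h1 : 0 ≤ t₁)
    (he : energy p f u t₂ = energy p f u t₁) {r : ℝ} (hr : r ∈ Ioo t₁ t₂) : rderiv u r = 0 := by
  have hN1 : 0 < ((N - 1 : ℕ) : ℝ) := by
    have : 1 < N := by exact_mod_cast hp.trans hN
    exact_mod_cast Nat.sub_pos_of_lt this
  have hanti := h.antitoneOn_energy hp hf
  have hr0 : 0 < r := h1.trans_lt hr.1
  have hconst : energy p f u =ᶠ[𝓝 r] fun _ => energy p f u t₁ := by
    filter_upwards [Ioo_mem_nhds hr.1 hr.2] with s hs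
    have h2 := hanti h1 (h1.trans hs.1.le) hs.1.le
    have h3 := hanti (h1.trans hs.1.le) ((h1.trans hs.1.le).trans hs.2.le) hs.2.le
    linarith
  have h4 := (h.hasDerivAt_energy hp hf hr0).unique
    ((hasDerivAt_const r (energy p f u t₁)).congr_of_eventuallyEq hconst)
  have h5 : |rderiv u r| ^ p = 0 := by
    have : 0 < ((N - 1 : ℕ) : ℝ) / r := by positivity
    have h6 : ((N - 1 : ℕ) : ℝ) / r * |rderiv u r| ^ p = 0 := by linarith
    exact (mul_eq_zero.mp h6).resolve_left this.ne'
  exact abs_eq_zero.mp ((Real.rpow_eq_zero (abs_nonneg _) (by linarith)).mp h5)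

lemma IsSolution.eq_of_energy_eq (hp : 1 < p) (hN : p < N) (hf : Continuous f)
    (h : IsSolution N p f lam u) {t₁ t₂ : ℝ} (h1 : 0 ≤ t₁)
    (he : energy p f u t₂ = energy p f u t₁) {r : ℝ} (hr : r ∈ Icc t₁ t₂) : u r = u t₁ := by
  rcases eq_or_lt_of_le hr.1 with rfl | hlt
  · rfl
  obtain ⟨c, hc, hce⟩ := exists_hasDerivAt_eq_slope u (rderiv u) hlt
    (h.continuousOn.mono fun _ hs => h1.trans hs.1) fun s hs => h.hasDerivAt (h1.trans_lt hs.1)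
  rw [h.rderiv_eq_zero_of_energy_eq hp hN hf h1 he ⟨hc.1, hc.2.trans_le hr.2⟩] at hce
  have := (div_eq_zero_iff.mp hce.symm).resolve_right (by linarith)
  linarith

/-- Once the energy is nonpositive at a point with `u ≠ 0`, it is negative from then on. -/
lemma IsSolution.energy_neg (hp : 1 < p) (hN : p < N) (hf : Continuous f) (h4 : H4 f)
    (h : IsSolution N p f lam u) {t r : ℝ} (ht : 0 ≤ t) (hE : energy p f u t ≤ 0)
    (hu : u t ≠ 0) (hr : t < r) : energy p f u r < 0 := by
  by_contra hcon
  have hanti := h.antitoneOn_energy hp hf ht (ht.trans hr.le) hr.le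
  have he : energy p f u r = energy p f u t := by linarith
  obtain ⟨c, hc1, hc2⟩ := exists_between hr
  have hc : c ∈ Ioo t r := ⟨hc1, hc2⟩
  have hc0 : 0 < c := ht.trans_lt hc1
  have hd : (fun s => phi p (rderiv u s)) =ᶠ[𝓝 c] fun _ => 0 := by
    filter_upwards [Ioo_mem_nhds hc1 hc2] with s hs
    rw [h.rderiv_eq_zero_of_energy_eq hp hN hf ht he hs, phi_zero]
  have h1 := (h.hasDerivAt_phi hc0).unique
    ((hasDerivAt_const c (0 : ℝ)).congr_of_eventuallyEq hd)
  rw [h.rderiv_eq_zero_of_energy_eq hp hN hf ht he hc, phi_zero,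
    h.eq_of_energy_eq hp hN hf ht he (Ioo_subset_Icc_self hc)] at h1
  have h2 := h4 (u t) hu (by linarith)
  have h5 : energy p f u c = primitive f (u c) := by
    simp [energy, h.rderiv_eq_zero_of_energy_eq hp hN hf ht he hc,
      Real.zero_rpow (by linarith : p ≠ 0)]
  rw [h.eq_of_energy_eq hp hN hf ht he (Ioo_subset_Icc_self hc)] at h5
  have h6 := h.antitoneOn_energy hp hf hc0.le (hc0.le.trans hc2.le) hc2.le
  linarith

end SolutionTransit

/-! ### The energy becomes nonpositive in finite time -/

section Exhaustion

variable {N : ℕ} {p : ℝ} {f : ℝ → ℝ} {lam : ℝ} {u : ℝ → ℝ} {β : ℝ}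

lemma one_le_cast_sub_one (hp : 1 < p) (hN : p < N) : (1 : ℝ) ≤ ((N - 1 : ℕ) : ℝ) := by
  have : 1 < N := by exact_mod_cast hp.trans hN
  exact_mod_cast Nat.le_sub_one_of_lt this

/-- Small dissipation over a time interval of length `3` forces `u` to be nearly constant there,
because `|d|^p ≥ ε^(p-1) (|d| - ε)`. -/
lemma IsSolution.abs_sub_le_of_drop (hp : 1 < p) (hN : p < N) (hf : Continuous f)
    (h : IsSolution N p f lam u) {t ε : ℝ} (ht : 1 ≤ t) (hε : 0 < ε)
    (hdrop : energy p f u t - energy p f u (t + 3) < ε ^ p / (t + 3)) {r : ℝ}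
    (hr : r ∈ Icc t (t + 3)) : |u r - u t| ≤ 4 * ε := by
  have hR : 0 < t + 3 := by linarith
  have hεp : ε ^ p = ε ^ (p - 1) * ε := by
    rw [← Real.rpow_add_one hε.ne']; congr 1; ring
  have hε1 : 0 < ε ^ (p - 1) := Real.rpow_pos_of_pos hε _
  have hyoung : ∀ x : ℝ, ε ^ (p - 1) * (|x| - ε) ≤ |x| ^ p := by
    intro x
    rcases le_or_gt |x| ε with hx | hx
    · exact (mul_nonpos_of_nonneg_of_nonpos hε1.le (by linarith)).trans
        (Real.rpow_nonneg (abs_nonneg _) _)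
    · have hx0 : 0 < |x| := hε.trans hx
      have h1 : |x| ^ p = |x| ^ (p - 1) * |x| := by
        rw [← Real.rpow_add_one hx0.ne']; congr 1; ring
      rw [h1]
      have h2 : ε ^ (p - 1) ≤ |x| ^ (p - 1) := Real.rpow_le_rpow hε.le hx.le (by linarith)
      nlinarith
  have key : ∀ σ : ℝ, |σ| = 1 → σ * (u r - u t) ≤ 4 * ε := by
    intro σ hσ
    rcases eq_or_lt_of_le hr.1 with rfl | hlt
    · simp; positivity
    have hcont : ContinuousOn (fun s => energy p f u s +
        ε ^ (p - 1) / (t + 3) * (σ * u s - ε * s)) (Icc t r) := by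
      have hsub : Icc t r ⊆ Ici 0 := fun s hs => (by linarith : (0 : ℝ) ≤ t).trans hs.1
      exact ((h.continuousOn_energy hp hf).mono hsub).add (continuousOn_const.mul
        ((continuousOn_const.mul (h.continuousOn.mono hsub)).sub
          (continuousOn_const.mul continuousOn_id)))
    obtain ⟨c, hc, hce⟩ := exists_hasDerivAt_eq_slope _
      (fun s => -(((N - 1 : ℕ) : ℝ) / s * |rderiv u s| ^ p) +
        ε ^ (p - 1) / (t + 3) * (σ * rderiv u s - ε * 1)) hlt hcont
      (fun s hs => by
        have hs0 : 0 < s := by linarith [hs.1]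
        exact (h.hasDerivAt_energy hp hf hs0).add
          ((((h.hasDerivAt hs0).const_mul σ).sub ((hasDerivAt_id s).const_mul ε)).const_mul _))
    have hc0 : 0 < c := by linarith [hc.1]
    have h1 : σ * rderiv u c ≤ |rderiv u c| := by
      calc σ * rderiv u c ≤ |σ * rderiv u c| := le_abs_self _
        _ = |rderiv u c| := by rw [abs_mul, hσ, one_mul]
    have h2 : 1 / (t + 3) * |rderiv u c| ^ p ≤ ((N - 1 : ℕ) : ℝ) / c * |rderiv u c| ^ p := by
      refine mul_le_mul_of_nonneg_right ?_ (Real.rpow_nonneg (abs_nonneg _) _)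
      exact div_le_div₀ (Nat.cast_nonneg _) (one_le_cast_sub_one hp hN) hc0
        (by linarith [hc.2, hr.2])
    have h3 : ε ^ (p - 1) / (t + 3) * (σ * rderiv u c - ε * 1) ≤
        1 / (t + 3) * |rderiv u c| ^ p := by
      rw [div_mul_eq_mul_div, one_div_mul_eq_div]
      refine div_le_div_of_nonneg_right ?_ hR.le
      refine le_trans (mul_le_mul_of_nonneg_left ?_ hε1.le) (hyoung (rderiv u c))
      linarith
    have h4 : (energy p f u r + ε ^ (p - 1) / (t + 3) * (σ * u r - ε * r)) -
        (energy p f u t + ε ^ (p - 1) / (t + 3) * (σ * u t - ε * t)) ≤ 0 := by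
      have h5 := (div_nonpos_iff.mp (hce ▸ (by linarith) :
        ((energy p f u r + ε ^ (p - 1) / (t + 3) * (σ * u r - ε * r)) -
        (energy p f u t + ε ^ (p - 1) / (t + 3) * (σ * u t - ε * t))) / (r - t) ≤ 0))
      rcases h5 with h5 | h5
      · linarith [h5.2]
      · exact h5.1
    have h6 := h.antitoneOn_energy hp hf (show (0 : ℝ) ≤ r by linarith)
      (show (0 : ℝ) ≤ t + 3 by linarith) hr.2
    have h7 : ε ^ (p - 1) / (t + 3) * (σ * (u r - u t) - ε * (r - t)) <
        ε ^ (p - 1) / (t + 3) * ε := by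
      have : ε ^ p / (t + 3) = ε ^ (p - 1) / (t + 3) * ε := by rw [hεp]; ring
      linarith
    have h8 := lt_of_mul_lt_mul_left h7 (by positivity)
    nlinarith [hr.2]
  rw [abs_le]
  constructor
  · linarith [key (-1) (by simp)]
  · linarith [key 1 (by simp)]

/-- Quantitative dissipation: if the energy stays positive, a solution that is outside the well at
time `t` loses an energy of at least `κ / (t + 3)` during `[t, t + 3]`. Otherwise `u` would be nearly constant with small
`u'`, near a point where `F ≥ 0` and `f = 0`, which (H4) excludes. -/
lemma IsSolution.exists_drop (hp : 1 < p) (hN : p < N) (hf : Continuous f) (h4 : H4 f)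
    (h5 : H5 p f) (hβ : 0 < β) (h : IsSolution N p f lam u)
    (hE : ∀ r, 0 ≤ r → 0 < energy p f u r) :
    ∃ κ, 0 < κ ∧ ∀ t, 1 ≤ t → β ≤ |u t| →
      κ / (t + 3) ≤ energy p f u t - energy p f u (t + 3) := by
  obtain ⟨U, hU, hUb⟩ := exists_bound_of_primitive_le hp hf h5 (energy p f u 0)
  have hu : ∀ r, 0 ≤ r → |u r| ≤ U := fun r hr => hUb _
    ((primitive_le_energy hp r).trans (h.antitoneOn_energy hp hf self_mem_Ici hr hr))
  obtain ⟨m, hm, hmK⟩ : ∃ m, 0 < m ∧ ∀ x, β / 2 ≤ |x| → |x| ≤ U →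
      m ≤ max |f x| (-primitive f x) := by
    have hK : IsCompact {x : ℝ | β / 2 ≤ |x| ∧ |x| ≤ U} := by
      refine (isCompact_Icc (a := -U) (b := U)).of_isClosed_subset ?_
        fun x hx => abs_le.mp hx.2
      exact (isClosed_le continuous_const continuous_abs).inter
        (isClosed_le continuous_abs continuous_const)
    have hg : Continuous fun x => max |f x| (-primitive f x) :=
      hf.abs.max (continuous_primitive hf).neg
    obtain ⟨m, hm, hm'⟩ := hK.exists_forall_le' hg.continuousOn (a := 0) fun x hx => by
      rcases eq_or_ne (f x) 0 with h0 | h0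
      · have hx0 : x ≠ 0 := by
          rintro rfl
          have := hx.1
          rw [abs_zero] at this
          linarith
        exact lt_max_of_lt_right (neg_pos.mpr (h4 x hx0 h0))
      · exact lt_max_of_lt_left (abs_pos.mpr h0)
    exact ⟨m, hm, fun x hx1 hx2 => hm' x ⟨hx1, hx2⟩⟩
  obtain ⟨A, hA⟩ : ∃ A, ∀ x ∈ Icc (-U) U, ‖f x‖ ≤ A :=
    isCompact_Icc.exists_bound_of_continuousOn hf.continuousOn
  obtain ⟨e, he0, heβ, he1, he2⟩ : ∃ e : ℝ, 0 < e ∧ e < β / 2 ∧ e ^ p + A * e < m ∧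
      2 * 4 ^ (N - 1) * e ^ (p - 1) < m := by
    have t1 : Tendsto (fun e : ℝ => e ^ p + A * e) (𝓝[>] 0) (𝓝 0) := by
      have : ContinuousAt (fun e : ℝ => e ^ p + A * e) 0 :=
        (Real.continuousAt_rpow_const _ _ (Or.inr (by linarith))).add
          (continuousAt_const.mul continuousAt_id)
      have h2 := this.tendsto
      rw [Real.zero_rpow (by linarith), mul_zero, add_zero] at h2
      exact h2.mono_left nhdsWithin_le_nhds
    have t2 : Tendsto (fun e : ℝ => 2 * 4 ^ (N - 1) * e ^ (p - 1)) (𝓝[>] 0) (𝓝 0) := by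
      have : ContinuousAt (fun e : ℝ => 2 * 4 ^ (N - 1) * e ^ (p - 1)) 0 :=
        continuousAt_const.mul (Real.continuousAt_rpow_const _ _ (Or.inr (by linarith)))
      have h2 := this.tendsto
      rw [Real.zero_rpow (by linarith), mul_zero] at h2
      exact h2.mono_left nhdsWithin_le_nhds
    have t3 : ∀ᶠ e : ℝ in 𝓝[>] 0, e < β / 2 :=
      (eventually_lt_nhds (by linarith)).filter_mono nhdsWithin_le_nhds
    obtain ⟨e, ha, hb, hc, hd⟩ := (((t1.eventually_lt_const hm).and
      ((t2.eventually_lt_const hm).and (t3.and self_mem_nhdsWithin))).exists)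
    exact ⟨e, hd, hc, ha, hb⟩
  refine ⟨(e / 8) ^ p, by positivity, fun t ht hut => ?_⟩
  by_contra hcon
  push Not at hcon
  have hnear : ∀ r ∈ Icc t (t + 3), |u r - u t| ≤ e / 2 := fun r hr => by
    have := h.abs_sub_le_of_drop hp hN hf ht (by positivity) hcon hr
    linarith
  have hnear2 : ∀ r ∈ Icc t (t + 3), ∀ s ∈ Icc t (t + 3), |u r - u s| ≤ e := by
    intro r hr s hs
    have h1 := abs_le.mp (hnear r hr)
    have h2 := abs_le.mp (hnear s hs)
    rw [abs_le]
    constructor <;> linarith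
  -- In each unit interval the mean value theorem gives a point where `u'` is small.
  have hsmall : ∀ a, t ≤ a → a + 1 ≤ t + 3 → ∃ ξ ∈ Ioo a (a + 1), |rderiv u ξ| ≤ e := by
    intro a ha1 ha2
    obtain ⟨ξ, hξ, hξe⟩ := exists_hasDerivAt_eq_slope u (rderiv u) (lt_add_one a)
      (h.continuousOn.mono fun _ hs => (by linarith : (0 : ℝ) ≤ a).trans hs.1)
      fun s hs => h.hasDerivAt (by linarith [hs.1])
    refine ⟨ξ, hξ, ?_⟩
    rw [hξe, add_sub_cancel_left, div_one]
    exact hnear2 _ ⟨by linarith, ha2⟩ _ ⟨ha1, by linarith⟩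
  obtain ⟨ξ₁, hξ₁, hd₁⟩ := hsmall t le_rfl (by linarith)
  obtain ⟨ξ₂, hξ₂, hd₂⟩ := hsmall (t + 2) (by linarith) (by linarith)
  have hξ₁I : ξ₁ ∈ Icc t (t + 3) := ⟨hξ₁.1.le, by linarith [hξ₁.2]⟩
  have hξ₁0 : 0 < ξ₁ := by linarith [hξ₁.1]
  have hF₁ : -(e ^ p) < primitive f (u ξ₁) := by
    have h1 := le_abs_rderiv_rpow (f := f) (u := u) hp ξ₁
    have h2 := hE ξ₁ hξ₁0.le
    have h3 : |rderiv u ξ₁| ^ p ≤ e ^ p := Real.rpow_le_rpow (abs_nonneg _) hd₁ (by linarith)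
    linarith
  have hfbig : ∀ r ∈ Icc t (t + 3), m ≤ |f (u r)| := by
    intro r hr
    have hr0 : 0 ≤ r := by linarith [hr.1]
    have h1 : β / 2 ≤ |u r| := by
      have h2 := hnear r hr
      have h3 := abs_sub_abs_le_abs_sub (u t) (u r)
      rw [abs_sub_comm] at h3
      linarith
    have hLip : |primitive f (u ξ₁) - primitive f (u r)| ≤ A * |u ξ₁ - u r| :=
      (convex_Icc (-U) U).norm_image_sub_le_of_norm_hasDerivWithin_le
        (fun x _ => (hasDerivAt_primitive hf x).hasDerivWithinAt) hA
        (abs_le.mp (hu r hr0)) (abs_le.mp (hu ξ₁ hξ₁0.le))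
    have hA0 : 0 ≤ A := (norm_nonneg _).trans (hA 0 ⟨by linarith, hU.le⟩)
    have h2 : A * |u ξ₁ - u r| ≤ A * e := mul_le_mul_of_nonneg_left (hnear2 _ hξ₁I _ hr) hA0
    have h3 := le_abs_self (primitive f (u ξ₁) - primitive f (u r))
    exact (le_max_iff.mp (hmK _ h1 (hu r hr0))).resolve_right (by linarith)
  have hlt : ξ₁ < ξ₂ := by linarith [hξ₁.2, hξ₂.1]
  obtain ⟨c, hc, hce⟩ := exists_hasDerivAt_eq_slope
    (fun s => s ^ (N - 1) * phi p (rderiv u s)) (fun s => -(s ^ (N - 1) * f (u s))) hlt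
    (fun s hs => (h.hasDerivAt_flux (hξ₁0.trans_le hs.1)).continuousAt.continuousWithinAt)
    fun s hs => h.hasDerivAt_flux (hξ₁0.trans hs.1)
  have hc0 : 0 < c := hξ₁0.trans hc.1
  have hP : ∀ ξ, 0 < ξ → ξ ≤ ξ₂ → |rderiv u ξ| ≤ e →
      |ξ ^ (N - 1) * phi p (rderiv u ξ)| ≤ (4 * ξ₁) ^ (N - 1) * e ^ (p - 1) := by
    intro ξ h0 h2 hd
    rw [abs_mul, abs_phi hp, abs_of_pos (pow_pos h0 _)]
    refine mul_le_mul (pow_le_pow_left₀ h0.le ?_ _)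
      (Real.rpow_le_rpow (abs_nonneg _) hd (by linarith))
      (Real.rpow_nonneg (abs_nonneg _) _) (by positivity)
    linarith [hξ₂.2, hξ₁.1]
  have h1 := hP ξ₁ hξ₁0 hlt.le hd₁
  have h2 := hP ξ₂ (hξ₁0.trans hlt) le_rfl hd₂
  have h3 : ξ₁ ^ (N - 1) * m ≤ |-(c ^ (N - 1) * f (u c))| := by
    rw [abs_neg, abs_mul, abs_of_pos (pow_pos hc0 _)]
    exact mul_le_mul (pow_le_pow_left₀ hξ₁0.le hc.1.le _)
      (hfbig c ⟨by linarith [hc.1, hξ₁.1], by linarith [hc.2, hξ₂.2]⟩) hm.le (by positivity)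
  rw [hce, abs_div, abs_of_pos (by linarith : 0 < ξ₂ - ξ₁)] at h3
  have h6 : |ξ₂ ^ (N - 1) * phi p (rderiv u ξ₂) - ξ₁ ^ (N - 1) * phi p (rderiv u ξ₁)| /
      (ξ₂ - ξ₁) ≤ |ξ₂ ^ (N - 1) * phi p (rderiv u ξ₂) - ξ₁ ^ (N - 1) * phi p (rderiv u ξ₁)| :=
    div_le_self (abs_nonneg _) (by linarith [hξ₁.2, hξ₂.1])
  have h7 := abs_sub (ξ₂ ^ (N - 1) * phi p (rderiv u ξ₂)) (ξ₁ ^ (N - 1) * phi p (rderiv u ξ₁))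
  have h8 : ξ₁ ^ (N - 1) * m ≤ ξ₁ ^ (N - 1) * (2 * 4 ^ (N - 1) * e ^ (p - 1)) := by
    rw [mul_pow] at h1 h2
    nlinarith
  have := le_of_mul_le_mul_left h8 (pow_pos hξ₁0 _)
  linarith

/-- Every solution runs out of energy: solutions of positive energy leave the well `[-β, β]` within
a bounded time, hence lose an amount of energy comparable to `1/r` in every interval of a fixed
length, and the harmonic series diverges. -/
lemma IsSolution.exists_energy_nonpos (hp : 1 < p) (hN : p < N) (hf : Continuous f) (h4 : H4 f)
    (h5 : H5 p f) (hw : IsWell p f β) (h : IsSolution N p f lam u) :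
    ∃ r, 0 ≤ r ∧ energy p f u r ≤ 0 := by
  by_contra hcon
  push Not at hcon
  obtain ⟨κ, hκ, hdrop⟩ := h.exists_drop hp hN hf h4 h5 hw.pos hcon
  have hT := transitTime_nonneg p f β
  set L := 2 * transitTime p f β + 4 with hL
  have hstep : ∀ t, 1 ≤ t → energy p f u (t + L) ≤ energy p f u t - κ / (t + L) := by
    intro t ht
    obtain ⟨t₁, ht₁, hut₁⟩ : ∃ t₁ ∈ Icc t (t + (2 * transitTime p f β + 1)), β ≤ |u t₁| := by
      by_contra hno
      push Not at hno
      have := h.sub_le_well hp hf hw (by linarith) (by linarith : t ≤ t + _)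
        (fun r hr => (hno r hr).le) fun r hr => hcon r (by linarith [hr.1])
      linarith
    have h1 := hdrop t₁ (ht.trans ht₁.1) hut₁
    have h2 := h.antitoneOn_energy hp hf (show (0 : ℝ) ≤ t by linarith)
      (show (0 : ℝ) ≤ t₁ by linarith [ht₁.1]) ht₁.1
    have h3 := h.antitoneOn_energy hp hf (show (0 : ℝ) ≤ t₁ + 3 by linarith [ht₁.1])
      (show (0 : ℝ) ≤ t + L by linarith) (by linarith [ht₁.2])
    have h6 : κ / (t + L) ≤ κ / (t₁ + 3) :=
      div_le_div_of_nonneg_left hκ.le (by linarith [ht₁.1]) (by linarith [ht₁.2])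
    linarith
  have hsum : ∀ n : ℕ, energy p f u (1 + n * L) ≤
      energy p f u 1 - κ / (1 + L) * ∑ i ∈ Finset.range n, 1 / ((i : ℝ) + 1) := by
    intro n
    induction n with
    | zero => simp
    | succ n ih =>
      have h1 := hstep (1 + n * L) (by
        have : (0 : ℝ) ≤ n * L := by positivity
        linarith)
      have h2 : κ / (1 + L) * (1 / ((n : ℝ) + 1)) ≤ κ / (1 + n * L + L) := by
        rw [div_mul_div_comm, mul_one]
        refine div_le_div_of_nonneg_left hκ.le (by positivity) ?_
        have : (0 : ℝ) ≤ n := Nat.cast_nonneg n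
        nlinarith
      have h3 : 1 + ((n + 1 : ℕ) : ℝ) * L = 1 + n * L + L := by push_cast; ring
      rw [h3, Finset.sum_range_succ, mul_add (κ / (1 + L))]
      linarith
  have hκL : 0 < κ / (1 + L) := by positivity
  obtain ⟨n, hn⟩ := ((Real.tendsto_sum_range_one_div_nat_succ_atTop.const_mul_atTop
    hκL).eventually_gt_atTop (energy p f u 1)).exists
  have h1 := hsum n
  have h2 := hcon (1 + n * L) (by positivity)
  linarith

end Exhaustion

/-! ### Uniqueness as long as the energy is positive -/

section Uniqueness

variable {N : ℕ} {p : ℝ} {f : ℝ → ℝ} {lam mu : ℝ} {u v : ℝ → ℝ}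

/-- The vector field of the first-order system for `(u, E)` on the region where `u'` has the
sign `σ`; the argument is `(r, (u, E))`. -/
noncomputable def energyField (N : ℕ) (p : ℝ) (f : ℝ → ℝ) (σ : ℝ) (q : ℝ × (ℝ × ℝ)) : ℝ × ℝ :=
  (σ * (p / (p - 1) * (q.2.2 - primitive f q.2.1)) ^ (1 / p),
    -(((N - 1 : ℕ) : ℝ) / q.1 * (p / (p - 1) * (q.2.2 - primitive f q.2.1))))

lemma contDiffAt_energyField (hf : Continuous f) (σ : ℝ) {q : ℝ × (ℝ × ℝ)} (hq : q.1 ≠ 0)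
    (hw : p / (p - 1) * (q.2.2 - primitive f q.2.1) ≠ 0) :
    ContDiffAt ℝ 1 (energyField N p f σ) q := by
  have h1 : ContDiffAt ℝ 1
      (fun q : ℝ × (ℝ × ℝ) => p / (p - 1) * (q.2.2 - primitive f q.2.1)) q := by
    refine contDiffAt_const.mul (ContDiffAt.sub ?_ ?_)
    · exact contDiffAt_snd.comp q contDiffAt_snd
    · exact (contDiff_primitive hf).contDiffAt.comp q (contDiffAt_fst.comp q contDiffAt_snd)
  exact (contDiffAt_const.mul (h1.rpow_const_of_ne hw)).prodMk
    ((contDiffAt_const.div contDiffAt_fst hq).mul h1).neg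

lemma IsSolution.hasDerivAt_energyField (hp : 1 < p) (hf : Continuous f)
    (h : IsSolution N p f lam u) {σ r : ℝ} (hr : 0 < r) (hσ : |σ| = 1)
    (hd : 0 < σ * rderiv u r) :
    HasDerivAt (fun s => (u s, energy p f u s))
      (energyField N p f σ (r, (u r, energy p f u r))) r := by
  have h1 : rderiv u r = σ * |rderiv u r| := by
    have hσ2 : σ * σ = 1 := by rw [← abs_mul_abs_self, hσ, one_mul]
    have h2 : |rderiv u r| = σ * rderiv u r := by
      rw [← abs_of_pos hd, abs_mul, hσ, one_mul]
    rw [h2, ← mul_assoc, hσ2, one_mul]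
  refine ((h.hasDerivAt hr).prodMk (h.hasDerivAt_energy hp hf hr)).congr_deriv ?_
  unfold energyField
  simp only [← abs_rderiv_rpow hp]
  rw [← Real.rpow_mul (abs_nonneg _), mul_one_div_cancel (by linarith), Real.rpow_one, ← h1]

/-- Uniqueness to the right of a point with `u' ≠ 0`. The pair `(u, E)` solves a first-order system
with a `C¹` right-hand side there, since `F` is `C¹` even where `f` is not Lipschitz. -/
lemma IsSolution.eq_right_of_rderiv_ne_zero (hp : 1 < p) (hf : Continuous f)
    (h : IsSolution N p f lam u) (k : IsSolution N p f mu v) {x : ℝ} (hx : 0 < x)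
    (huv : u x = v x) (hduv : rderiv u x = rderiv v x) (hne : rderiv u x ≠ 0) :
    ∃ ε, 0 < ε ∧ EqOn u v (Icc x (x + ε)) := by
  obtain ⟨σ, hσ, hσd⟩ : ∃ σ : ℝ, |σ| = 1 ∧ 0 < σ * rderiv u x := by
    rcases lt_or_gt_of_ne hne with h0 | h0
    · exact ⟨-1, by simp, by linarith⟩
    · exact ⟨1, by simp, by linarith⟩
  have hE : energy p f u x = energy p f v x := by unfold energy; rw [huv, hduv]
  obtain ⟨K, W, hW, hLip⟩ := (contDiffAt_energyField (N := N) (p := p) hf σ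
    (q := (x, (u x, energy p f u x))) hx.ne' (by
      rw [← abs_rderiv_rpow hp]
      exact (Real.rpow_pos_of_pos (abs_pos.mpr hne) _).ne')).exists_lipschitzOnWith
  have hnear : ∀ {lam : ℝ} {w : ℝ → ℝ}, IsSolution N p f lam w → u x = w x →
      rderiv u x = rderiv w x → ∀ᶠ r in 𝓝 x, (r, (w r, energy p f w r)) ∈ W ∧
        0 < σ * rderiv w r := by
    intro lam w hs hw0 hw1
    have hE : energy p f u x = energy p f w x := by unfold energy; rw [hw0, hw1]
    have c1 : ContinuousAt (fun r => (r, (w r, energy p f w r))) x :=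
      continuousAt_id.prodMk
        ((hs.hasDerivAt hx).continuousAt.prodMk (hs.hasDerivAt_energy hp hf hx).continuousAt)
    have c2 : ContinuousAt (fun r => σ * rderiv w r) x :=
      continuousAt_const.mul (hs.continuousOn_rderiv.continuousAt (Ici_mem_nhds hx))
    rw [hw0, hE] at hW
    rw [hw1] at hσd
    exact (c1.eventually_mem hW).and (c2.eventually_const_lt hσd)
  obtain ⟨ε, hε, hball⟩ := Metric.eventually_nhds_iff.mp
    (((hnear h rfl rfl).and (hnear k huv hduv)).and (eventually_gt_nhds hx))
  have hI : ∀ r ∈ Icc x (x + ε / 2), dist r x < ε := fun r hr => by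
    rw [Real.dist_eq, abs_of_nonneg (by linarith [hr.1])]
    linarith [hr.2]
  refine ⟨ε / 2, by positivity, ?_⟩
  have hsol : ∀ {lam : ℝ} {w : ℝ → ℝ}, IsSolution N p f lam w →
      ContinuousOn (fun s => (w s, energy p f w s)) (Icc x (x + ε / 2)) := by
    intro lam w hs r hr
    have hr0 : 0 < r := hx.trans_le hr.1
    exact ((hs.hasDerivAt hr0).continuousAt.prodMk
      (hs.hasDerivAt_energy hp hf hr0).continuousAt).continuousWithinAt
  have hmain := ODE_solution_unique_of_mem_Icc_right
    (v := fun t y => energyField N p f σ (t, y)) (s := fun t => {y | (t, y) ∈ W}) (K := K)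
    (f := fun s => (u s, energy p f u s)) (g := fun s => (v s, energy p f v s))
    (a := x) (b := x + ε / 2) ?_ (hsol h) ?_ ?_ (hsol k) ?_ ?_ ?_
  · intro r hr
    exact congrArg Prod.fst (hmain hr)
  · intro t _ y hy z hz
    have := hLip hy hz
    simpa [Prod.edist_eq] using this
  · intro r hr
    have hb := hball (hI r (Ico_subset_Icc_self hr))
    exact (h.hasDerivAt_energyField hp hf hb.2 hσ hb.1.1.2).hasDerivWithinAt
  · intro r hr
    exact (hball (hI r (Ico_subset_Icc_self hr))).1.1.1
  · intro r hr
    have hb := hball (hI r (Ico_subset_Icc_self hr))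
    exact (k.hasDerivAt_energyField hp hf hb.2 hσ hb.1.2.2).hasDerivWithinAt
  · intro r hr
    exact (hball (hI r (Ico_subset_Icc_self hr))).1.2.1
  · simp only [huv, hE]

/-- To the right of a critical point `x`, the flux equals `(r^N - x^N)/N` times a value
of `-f(u)`. -/
lemma IsSolution.exists_flux_eq (hp : 1 < p) (hN : p < N) (h : IsSolution N p f lam u)
    {x r : ℝ} (hx : 0 ≤ x) (hxr : x < r) (hd : rderiv u x = 0) :
    ∃ ζ ∈ Ioo x r, r ^ (N - 1) * phi p (rderiv u r) = (r ^ N - x ^ N) / N * -f (u ζ) := by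
  have hN0 : (N : ℝ) ≠ 0 := by linarith
  obtain ⟨ζ, hζ, he⟩ := exists_ratio_hasDerivAt_eq_ratio_slope
    (fun s : ℝ => s ^ N / N) (fun s => s ^ (N - 1)) hxr (by fun_prop)
    (fun s _ => ((hasDerivAt_pow N s).div_const (N : ℝ)).congr_deriv (by field_simp))
    (fun s => s ^ (N - 1) * phi p (rderiv u s)) (fun s => -(s ^ (N - 1) * f (u s)))
    (((continuous_pow _).continuousOn).mul ((continuous_phi hp).comp_continuousOn
      (h.continuousOn_rderiv.mono fun s hs => hx.trans hs.1)))
    fun s hs => h.hasDerivAt_flux (hx.trans_lt hs.1)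
  refine ⟨ζ, hζ, ?_⟩
  have hζ0 : ζ ^ (N - 1) ≠ 0 := pow_ne_zero _ (hx.trans_lt hζ.1).ne'
  simp only [hd, phi_zero, mul_zero, sub_zero] at he
  refine mul_right_cancel₀ hζ0 ?_
  rw [he]; ring

lemma IsSolution.exists_flux_sub_eq (hp : 1 < p) (hN : p < N) (h : IsSolution N p f lam u)
    (k : IsSolution N p f mu v) {x r : ℝ} (hx : 0 ≤ x) (hxr : x < r) (hd : rderiv u x = 0)
    (hd' : rderiv v x = 0) :
    ∃ ζ ∈ Ioo x r, r ^ (N - 1) * phi p (rderiv u r) - r ^ (N - 1) * phi p (rderiv v r) =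
      (r ^ N - x ^ N) / N * (f (v ζ) - f (u ζ)) := by
  have hN0 : (N : ℝ) ≠ 0 := by linarith
  have hc : ∀ {lam : ℝ} {w : ℝ → ℝ}, IsSolution N p f lam w →
      ContinuousOn (fun s => s ^ (N - 1) * phi p (rderiv w s)) (Icc x r) := fun hs =>
    ((continuous_pow _).continuousOn).mul ((continuous_phi hp).comp_continuousOn
      (hs.continuousOn_rderiv.mono fun s hs => hx.trans hs.1))
  obtain ⟨ζ, hζ, he⟩ := exists_ratio_hasDerivAt_eq_ratio_slope
    (fun s : ℝ => s ^ N / N) (fun s => s ^ (N - 1)) hxr (by fun_prop)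
    (fun s _ => ((hasDerivAt_pow N s).div_const (N : ℝ)).congr_deriv (by field_simp))
    (fun s => s ^ (N - 1) * phi p (rderiv u s) - s ^ (N - 1) * phi p (rderiv v s))
    (fun s => -(s ^ (N - 1) * f (u s)) - -(s ^ (N - 1) * f (v s)))
    ((hc h).sub (hc k))
    fun s hs => (h.hasDerivAt_flux (hx.trans_lt hs.1)).sub (k.hasDerivAt_flux (hx.trans_lt hs.1))
  refine ⟨ζ, hζ, ?_⟩
  have hζ0 : ζ ^ (N - 1) ≠ 0 := pow_ne_zero _ (hx.trans_lt hζ.1).ne'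
  simp only [hd, hd', phi_zero, mul_zero, sub_zero] at he
  refine mul_right_cancel₀ hζ0 ?_
  rw [he]; ring

/-- `(r^N - x^N)/N = B r^(N-1)` with `0 ≤ B ≤ r - x`. -/
lemma pow_sub_pow_div_bounds (hN : N ≠ 0) {x r : ℝ} (hx : 0 ≤ x) (hxr : x < r) :
    0 < (r ^ N - x ^ N) / N ∧ (r ^ N - x ^ N) / N ≤ r ^ (N - 1) * (r - x) := by
  have hN0 : (0 : ℝ) < N := by exact_mod_cast Nat.pos_of_ne_zero hN
  refine ⟨div_pos (sub_pos.mpr (pow_lt_pow_left₀ hxr hx hN)) hN0, ?_⟩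
  obtain ⟨ζ, hζ, he⟩ := exists_hasDerivAt_eq_slope
    (fun s : ℝ => s ^ N / N) (fun s => s ^ (N - 1)) hxr (by fun_prop)
    (fun s _ => ((hasDerivAt_pow N s).div_const (N : ℝ)).congr_deriv (by field_simp))
  rw [eq_div_iff (by linarith), ← sub_div] at he
  rw [← he]
  exact mul_le_mul_of_nonneg_right (pow_le_pow_left₀ (hx.trans hζ.1.le) hζ.2.le _) (by linarith)

/-- Uniqueness to the right of a critical point with `f(u) ≠ 0`, including `r = 0`. The flux is
comparable to `r - x` there, so that `φ_{p'}` acts as a Lipschitz map after rescaling, and the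
difference of two solutions contracts. -/
lemma IsSolution.eq_right_of_rderiv_eq_zero (hp : 1 < p) (hN : p < N) (h1 : H1 f)
    (h : IsSolution N p f lam u) (k : IsSolution N p f mu v) {x : ℝ} (hx : 0 ≤ x)
    (huv : u x = v x) (hdu : rderiv u x = 0) (hdv : rderiv v x = 0) (hf0 : f (u x) ≠ 0) :
    ∃ ε, 0 < ε ∧ EqOn u v (Icc x (x + ε)) := by
  have hux : u x ≠ 0 := fun h0 => hf0 (h0 ▸ h1.2.2)
  have hNn : N ≠ 0 := by rintro rfl; norm_num at hN; linarith
  obtain ⟨K₁, W₁, hW₁, hLip₁⟩ := h1.2.1 hux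
  rw [(isOpen_ne (x := (0 : ℝ))).nhdsWithin_eq hux] at hW₁
  obtain ⟨K₂, W₂, hW₂, hLip₂⟩ :=
    (contDiffAt_phi (p / (p - 1)) (neg_ne_zero.mpr hf0)).exists_lipschitzOnWith
  have hnear : ∀ {lam : ℝ} {w : ℝ → ℝ}, IsSolution N p f lam w → u x = w x →
      ∀ᶠ r in 𝓝[≥] x, w r ∈ W₁ ∧ -f (w r) ∈ W₂ := by
    intro lam w hs hw0
    have c1 : ContinuousWithinAt w (Ici x) x :=
      (hs.continuousOn x hx).mono (Ici_subset_Ici.mpr hx)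
    have c2 : ContinuousWithinAt (fun r => -f (w r)) (Ici x) x :=
      (h1.1.continuousAt.comp_continuousWithinAt c1).neg
    rw [hw0] at hW₁ hW₂
    exact (c1.eventually_mem hW₁).and (c2.eventually_mem hW₂)
  obtain ⟨b, hb, hbI⟩ := mem_nhdsGE_iff_exists_Icc_subset.mp
    ((hnear h rfl).and (hnear k huv))
  have hxb : x < b := hb
  set ε : ℝ := min (b - x) (min 1 (1 / (2 * (K₂ * K₁ + 1)))) with hεdef
  have hKK : (0 : ℝ) ≤ K₂ * K₁ := by positivity
  have hε : 0 < ε := lt_min (by linarith) (lt_min one_pos (by positivity))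
  have hεb : ε ≤ b - x := min_le_left _ _
  have hε1 : ε ≤ 1 := (min_le_right _ _).trans (min_le_left _ _)
  have hεK : K₂ * K₁ * ε ≤ 1 / 2 := by
    have h2 : ε ≤ 1 / (2 * (K₂ * K₁ + 1)) := (min_le_right _ _).trans (min_le_right _ _)
    rw [le_div_iff₀ (by positivity)] at h2
    nlinarith
  have hgood : ∀ r ∈ Icc x (x + ε), (u r ∈ W₁ ∧ -f (u r) ∈ W₂) ∧ (v r ∈ W₁ ∧ -f (v r) ∈ W₂) :=
    fun r hr => hbI ⟨hr.1, by linarith [hr.2]⟩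
  refine ⟨ε, hε, ?_⟩
  have hcont : ContinuousOn (fun r => |u r - v r|) (Icc x (x + ε)) :=
    ((h.continuousOn.mono fun s hs => hx.trans hs.1).sub
      (k.continuousOn.mono fun s hs => hx.trans hs.1)).abs
  obtain ⟨m, hm, hmax⟩ := isCompact_Icc.exists_isMaxOn
    (nonempty_Icc.mpr (by linarith : x ≤ x + ε)) hcont
  have hmax' : ∀ s ∈ Icc x (x + ε), |u s - v s| ≤ |u m - v m| := fun s hs => hmax hs
  have hdiff : ∀ r ∈ Ioc x (x + ε), |rderiv u r - rderiv v r| ≤ K₂ * K₁ * |u m - v m| := by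
    intro r hr
    have hr0 : 0 < r := hx.trans_lt hr.1
    have hrN : (0 : ℝ) < r ^ (N - 1) := pow_pos hr0 _
    obtain ⟨hA0, hA1⟩ := pow_sub_pow_div_bounds hNn hx hr.1
    set A := (r ^ N - x ^ N) / N with hA
    set B := A / r ^ (N - 1) with hB
    have hB0 : 0 ≤ B := by positivity
    have hB1 : B ≤ 1 := by
      rw [hB, div_le_one hrN]
      have : r - x ≤ 1 := by linarith [hr.2]
      nlinarith
    obtain ⟨ζ₁, hζ₁, e₁⟩ := h.exists_flux_eq hp hN hx hr.1 hdu
    obtain ⟨ζ₂, hζ₂, e₂⟩ := k.exists_flux_eq hp hN hx hr.1 hdv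
    obtain ⟨ζ₃, hζ₃, e₃⟩ := h.exists_flux_sub_eq hp hN k hx hr.1 hdu hdv
    have hsub : Ioo x r ⊆ Icc x (x + ε) := fun s hs => ⟨hs.1.le, hs.2.le.trans hr.2⟩
    have hP : ∀ {a y : ℝ}, r ^ (N - 1) * phi p a = A * y →
        a = phi (p / (p - 1)) B * phi (p / (p - 1)) y := by
      intro a y he
      rw [← phi_mul, ← phi_conj_phi hp a]
      congr 1
      rw [hB]; field_simp; linarith
    have hX : f (u ζ₁) - f (v ζ₂) = f (u ζ₃) - f (v ζ₃) := by
      rw [e₁, e₂] at e₃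
      have h2 : A * (f (u ζ₁) - f (v ζ₂)) = A * (f (u ζ₃) - f (v ζ₃)) := by linarith
      exact mul_left_cancel₀ hA0.ne' h2
    have hφB : |phi (p / (p - 1)) B| ≤ 1 := by
      rw [abs_phi (one_lt_conj hp), abs_of_nonneg hB0]
      exact Real.rpow_le_one hB0 hB1 (by linarith [one_lt_conj hp])
    have hL2 := hLip₂.dist_le_mul _ (hgood ζ₁ (hsub hζ₁)).1.2 _ (hgood ζ₂ (hsub hζ₂)).2.2
    have hL1 := hLip₁.dist_le_mul _ (hgood ζ₃ (hsub hζ₃)).1.1 _ (hgood ζ₃ (hsub hζ₃)).2.1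
    rw [Real.dist_eq, Real.dist_eq] at hL1 hL2
    have h3 : |-f (u ζ₁) - -f (v ζ₂)| = |f (u ζ₃) - f (v ζ₃)| := by
      rw [← hX, ← abs_neg]; congr 1; ring
    rw [hP e₁, hP e₂, ← mul_sub, abs_mul]
    calc |phi (p / (p - 1)) B| * |phi (p / (p - 1)) (-f (u ζ₁)) - phi (p / (p - 1)) (-f (v ζ₂))|
        ≤ 1 * (K₂ * |-f (u ζ₁) - -f (v ζ₂)|) :=
          mul_le_mul hφB hL2 (abs_nonneg _) zero_le_one
      _ ≤ K₂ * (K₁ * |u ζ₃ - v ζ₃|) := by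
          rw [one_mul, h3]; exact mul_le_mul_of_nonneg_left hL1 K₂.2
      _ ≤ K₂ * (K₁ * |u m - v m|) := by
          exact mul_le_mul_of_nonneg_left
            (mul_le_mul_of_nonneg_left (hmax' ζ₃ (hsub hζ₃)) K₁.2) K₂.2
      _ = K₂ * K₁ * |u m - v m| := by ring
  have hm0 : |u m - v m| = 0 := by
    rcases eq_or_lt_of_le hm.1 with rfl | hlt
    · rw [huv, sub_self, abs_zero]
    obtain ⟨ζ, hζ, he⟩ := exists_hasDerivAt_eq_slope (fun s => u s - v s)
      (fun s => rderiv u s - rderiv v s) hlt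
      ((h.continuousOn.mono fun s hs => hx.trans hs.1).sub
        (k.continuousOn.mono fun s hs => hx.trans hs.1))
      fun s hs => (h.hasDerivAt (hx.trans_lt hs.1)).sub (k.hasDerivAt (hx.trans_lt hs.1))
    have h2 := hdiff ζ ⟨hζ.1, hζ.2.le.trans hm.2⟩
    rw [he, huv, sub_self, sub_zero, abs_div, abs_of_pos (by linarith : 0 < m - x),
      div_le_iff₀ (by linarith)] at h2
    have h3 : K₂ * K₁ * |u m - v m| * (m - x) ≤ 1 / 2 * |u m - v m| := by
      calc K₂ * K₁ * |u m - v m| * (m - x) ≤ K₂ * K₁ * |u m - v m| * ε := by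
            gcongr; linarith [hm.2]
        _ = (K₂ * K₁ * ε) * |u m - v m| := by ring
        _ ≤ 1 / 2 * |u m - v m| := mul_le_mul_of_nonneg_right hεK (abs_nonneg _)
    linarith [abs_nonneg (u m - v m)]
  intro s hs
  have h2 := hmax' s hs
  rw [hm0] at h2
  exact sub_eq_zero.mp (abs_nonpos_iff.mp h2)

lemma rderiv_congr_of_eqOn {x y : ℝ} (hx : 0 ≤ x) (h : EqOn u v (Icc x y)) {r : ℝ}
    (hr : r ∈ Ioo x y) : rderiv u r = rderiv v r := by
  have h1 : u =ᶠ[𝓝 r] v := by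
    filter_upwards [Icc_mem_nhds hr.1 hr.2] with s hs using h hs
  exact (h1.filter_mono nhdsWithin_le_nhds).derivWithin_eq_of_mem (hx.trans hr.1.le)

/-- Two solutions with the same initial value agree, together with their derivatives, as long as
the energy is positive. -/
theorem IsSolution.eq_of_energy_pos (hp : 1 < p) (hN : p < N) (h1 : H1 f) (h4 : H4 f)
    (h : IsSolution N p f lam u) (k : IsSolution N p f lam v) {R : ℝ} (hR : 0 ≤ R)
    (hE : ∀ r ∈ Ico 0 R, 0 < energy p f u r) : u R = v R ∧ rderiv u R = rderiv v R := by
  have hmem : R ∈ {r | (u r, rderiv u r) = (v r, rderiv v r)} := by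
    refine IsClosed.mem_of_ge_of_forall_exists_gt (a := 0) ?_ ?_ hR ?_
    · have hc : ∀ {w : ℝ → ℝ}, IsSolution N p f lam w →
          ContinuousOn (fun r => (w r, rderiv w r)) (Icc 0 R) := fun hs =>
        (hs.continuousOn.prodMk hs.continuousOn_rderiv).mono fun r hr => hr.1
      rw [inter_comm]
      exact isClosed_Icc.isClosed_eq (hc h) (hc k)
    · simp [h.initial_value, k.initial_value, h.initial_deriv, k.initial_deriv]
    · rintro x ⟨hx, hxI⟩
      obtain ⟨e1, e2⟩ := Prod.mk.inj hx
      obtain ⟨ε, hε, heq⟩ : ∃ ε, 0 < ε ∧ EqOn u v (Icc x (x + ε)) := by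
        by_cases hd : rderiv u x = 0
        · refine h.eq_right_of_rderiv_eq_zero hp hN h1 k hxI.1 e1 hd (e2 ▸ hd) fun hf0 => ?_
          have hpos := hE x hxI
          have h2 : energy p f u x = primitive f (u x) := by
            simp [energy, hd, Real.zero_rpow (by linarith : p ≠ 0)]
          rw [h2] at hpos
          refine absurd (h4 (u x) (fun h0 => ?_) hf0) hpos.le.not_gt
          rw [h0, primitive_zero] at hpos
          exact lt_irrefl _ hpos
        · refine h.eq_right_of_rderiv_ne_zero hp h1.1 k (lt_of_le_of_ne hxI.1 ?_) e1 e2 hd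
          rintro rfl
          exact hd h.initial_deriv
      have hlt : x < min (x + ε) R := lt_min (by linarith) hxI.2
      obtain ⟨y, hy1, hy2⟩ := exists_between hlt
      have hyI : y ∈ Ioo x (x + ε) := ⟨hy1, hy2.trans_le (min_le_left _ _)⟩
      refine ⟨y, ?_, hy1, (hy2.trans_le (min_le_right _ _)).le⟩
      exact Prod.ext (heq (Ioo_subset_Icc_self hyI)) (rderiv_congr_of_eqOn hxI.1 heq hyI)
  exact Prod.mk.inj hmem

end Uniqueness

/-! ### Compactness of the set of solutions -/

section Compactness

variable {N : ℕ} {p : ℝ} {f : ℝ → ℝ} {lam₀ : ℝ}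

/-- The filter of solutions whose initial value tends to `lam₀`. -/
def solutionsNear (N : ℕ) (p : ℝ) (f : ℝ → ℝ) (lam₀ : ℝ) : Filter (ℝ → ℝ) :=
  comap (fun u => u 0) (𝓝 lam₀) ⊓ 𝓟 {u | IsSolution N p f (u 0) u}

lemma exists_delta_of_eventually {P : (ℝ → ℝ) → Prop}
    (h : ∀ᶠ u in solutionsNear N p f lam₀, P u) :
    ∃ δ : ℝ, 0 < δ ∧ ∀ lam : ℝ, 0 < lam → |lam - lam₀| < δ →
      ∀ u : ℝ → ℝ, IsSolution N p f lam u → P u := by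
  rw [solutionsNear, eventually_inf_principal, eventually_comap] at h
  obtain ⟨δ, hδ, hP⟩ := Metric.eventually_nhds_iff.mp h
  refine ⟨δ, hδ, fun lam _ hlam u hu => hP (y := lam) hlam u hu.initial_value ?_⟩
  rw [← hu.initial_value] at hu
  exact hu

lemma eventually_isSolution : ∀ᶠ v in solutionsNear N p f lam₀, IsSolution N p f (v 0) v :=
  mem_inf_of_right (mem_principal_self _)

lemma tendsto_initial_value : Tendsto (fun v : ℝ → ℝ => v 0) (solutionsNear N p f lam₀) (𝓝 lam₀) :=
  tendsto_comap.mono_left inf_le_left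

/-- Solutions with initial value near `lam₀` are bounded in `C¹`, because the energy is
nonincreasing and `F` is coercive. -/
lemma exists_C1_bound (hp : 1 < p) (hf : Continuous f) (h5 : H5 p f) :
    ∃ U V : ℝ, 0 ≤ V ∧ ∀ᶠ v in solutionsNear N p f lam₀, ∀ r, 0 ≤ r →
      |v r| ≤ U ∧ |rderiv v r| ≤ V := by
  obtain ⟨U, hU, hUb⟩ := exists_bound_of_primitive_le hp hf h5 (primitive f lam₀ + 1)
  obtain ⟨B, hB⟩ := (isCompact_Icc (a := -U) (b := U)).exists_bound_of_continuousOn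
    (continuous_primitive hf).continuousOn
  refine ⟨U, |p / (p - 1) * (primitive f lam₀ + 1 + B)| ^ (1 / p), by positivity, ?_⟩
  have hF : ∀ᶠ v in solutionsNear N p f lam₀, primitive f (v 0) < primitive f lam₀ + 1 :=
    (((continuous_primitive hf).tendsto lam₀).comp tendsto_initial_value).eventually_lt_const
      (lt_add_one _)
  filter_upwards [hF, eventually_isSolution] with v hv hs r hr
  have hE : energy p f v r ≤ primitive f lam₀ + 1 := by
    have := hs.antitoneOn_energy hp hf self_mem_Ici hr hr
    rw [hs.energy_zero hp] at this
    linarith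
  have h1 := hUb (v r) ((primitive_le_energy hp r).trans hE)
  refine ⟨h1, ?_⟩
  have h2 := hB (v r) (abs_le.mp h1)
  rw [Real.norm_eq_abs] at h2
  have h3 : |rderiv v r| ^ p ≤ |p / (p - 1) * (primitive f lam₀ + 1 + B)| := by
    rw [abs_rderiv_rpow (f := f) hp]
    refine le_trans (mul_le_mul_of_nonneg_left ?_ (by linarith [one_lt_conj hp])) (le_abs_self _)
    linarith [neg_abs_le (primitive f (v r))]
  calc |rderiv v r| = (|rderiv v r| ^ p) ^ (1 / p) := by
        rw [← Real.rpow_mul (abs_nonneg _), mul_one_div_cancel (by linarith), Real.rpow_one]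
    _ ≤ _ := Real.rpow_le_rpow (Real.rpow_nonneg (abs_nonneg _) _) h3 (by positivity)

/-- The function `-r^(1-N) ∫₀ʳ s^(N-1) f(u(s)) ds`, which equals `φ_p(u')` for a solution `u`. At
`r = 0` its value is `0`, as it should be. -/
noncomputable def sourceMean (N : ℕ) (f u : ℝ → ℝ) (r : ℝ) : ℝ :=
  -(∫ s in (0 : ℝ)..r, s ^ (N - 1) * f (u s)) / r ^ (N - 1)

lemma intervalIntegrable_source (hf : Continuous f) {u : ℝ → ℝ} (hu : ContinuousOn u (Ici 0))
    {r : ℝ} (hr : 0 ≤ r) :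
    IntervalIntegrable (fun s => s ^ (N - 1) * f (u s)) volume 0 r := by
  refine ContinuousOn.intervalIntegrable ?_
  rw [uIcc_of_le hr]
  exact (continuous_pow _).continuousOn.mul
    (hf.comp_continuousOn (hu.mono fun s hs => hs.1))

lemma sub_one_ne_zero_of_lt (hp : 1 < p) (hN : p < N) : N - 1 ≠ 0 := by
  have : 1 < N := by exact_mod_cast hp.trans hN
  omega

lemma IsSolution.phi_rderiv_eq (hp : 1 < p) (hN : p < N) (hf : Continuous f) {lam : ℝ}
    {u : ℝ → ℝ} (h : IsSolution N p f lam u) {r : ℝ} (hr : 0 ≤ r) :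
    phi p (rderiv u r) = sourceMean N f u r := by
  have hN1 := sub_one_ne_zero_of_lt hp hN
  rcases eq_or_lt_of_le hr with rfl | hr0
  · simp [sourceMean, h.initial_deriv, phi_zero]
  · have h1 := intervalIntegral.integral_eq_sub_of_hasDerivAt_of_le hr
      (f := fun s => s ^ (N - 1) * phi p (rderiv u s)) (f' := fun s => -(s ^ (N - 1) * f (u s)))
      ((continuous_pow _).continuousOn.mul ((continuous_phi hp).comp_continuousOn
        (h.continuousOn_rderiv.mono fun s hs => hs.1)))
      (fun s hs => h.hasDerivAt_flux hs.1) (intervalIntegrable_source hf h.continuousOn hr).neg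
    rw [intervalIntegral.integral_neg] at h1
    unfold sourceMean
    rw [h1, zero_pow hN1]
    have : r ^ (N - 1) ≠ 0 := pow_ne_zero _ hr0.ne'
    field_simp
    ring

lemma tendstoUniformlyOn_of_lipschitz {l : Filter (ℝ → ℝ)} {w : ℝ → ℝ} {V : ℝ} (hV : 0 ≤ V)
    (hLip : ∀ᶠ v in l, ∀ r, 0 ≤ r → ∀ s, 0 ≤ s → |v r - v s| ≤ V * |r - s|)
    (hw : ∀ r, 0 ≤ r → ∀ s, 0 ≤ s → |w r - w s| ≤ V * |r - s|)
    (hlim : ∀ r, 0 ≤ r → Tendsto (fun v : ℝ → ℝ => v r) l (𝓝 (w r))) (R : ℝ) :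
    TendstoUniformlyOn (fun v : ℝ → ℝ => v) w l (Icc 0 R) := by
  rw [← tendstoLocallyUniformlyOn_iff_tendstoUniformlyOn_of_compact isCompact_Icc,
    Metric.tendstoLocallyUniformlyOn_iff]
  intro ε hε x hx
  have hη : 0 < ε / (3 * (V + 1)) := by positivity
  refine ⟨Icc 0 R ∩ Metric.ball x (ε / (3 * (V + 1))),
    inter_mem self_mem_nhdsWithin (mem_nhdsWithin_of_mem_nhds (Metric.ball_mem_nhds x hη)), ?_⟩
  filter_upwards [hLip, Metric.tendsto_nhds.mp (hlim x hx.1) (ε / 3) (by positivity)]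
    with v hv hvx y hy
  have h1 := hw y hy.1.1 x hx.1
  have h2 := hv x hx.1 y hy.1.1
  have h3 : V * |y - x| ≤ ε / 3 := by
    have h4 : |y - x| < ε / (3 * (V + 1)) := hy.2
    rw [lt_div_iff₀ (by positivity)] at h4
    nlinarith [abs_nonneg (y - x)]
  rw [Real.dist_eq, abs_sub_comm] at hvx
  rw [abs_sub_comm x y] at h2
  rw [Real.dist_eq]
  calc |w y - v y| = |(w y - w x) + (w x - v x) + (v x - v y)| := by ring_nf
    _ ≤ |w y - w x| + |w x - v x| + |v x - v y| := abs_add_three _ _ _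
    _ < ε := by linarith

lemma tendstoUniformlyOn_sourceMean (hf : Continuous f) {l : Filter (ℝ → ℝ)} {w : ℝ → ℝ} {R : ℝ}
    (hwc : ContinuousOn w (Ici 0)) (hvc : ∀ᶠ v in l, ContinuousOn v (Ici 0))
    (h : TendstoUniformlyOn (fun v : ℝ → ℝ => f ∘ v) (f ∘ w) l (Icc 0 R)) :
    TendstoUniformlyOn (fun v : ℝ → ℝ => sourceMean N f v) (sourceMean N f w) l (Icc 0 R) := by
  rw [Metric.tendstoUniformlyOn_iff] at h ⊢
  intro ε hε
  filter_upwards [h (ε / (|R| + 1)) (by positivity), hvc] with v hv hvc r hr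
  rcases eq_or_lt_of_le hr.1 with rfl | hr0
  · simpa [sourceMean] using hε
  have hrN : (0 : ℝ) < r ^ (N - 1) := pow_pos hr0 _
  have h1 : ‖∫ s in (0 : ℝ)..r, (s ^ (N - 1) * f (v s) - s ^ (N - 1) * f (w s))‖ ≤
      r ^ (N - 1) * (ε / (|R| + 1)) * |r - 0| := by
    refine intervalIntegral.norm_integral_le_of_norm_le_const fun s hs => ?_
    rw [uIoc_of_le hr.1] at hs
    have h2 : dist (f (w s)) (f (v s)) < ε / (|R| + 1) := hv s ⟨hs.1.le, hs.2.trans hr.2⟩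
    rw [dist_comm, Real.dist_eq] at h2
    rw [← mul_sub, norm_mul, norm_pow, Real.norm_of_nonneg hs.1.le, Real.norm_eq_abs]
    exact mul_le_mul (pow_le_pow_left₀ hs.1.le hs.2 _) h2.le (abs_nonneg _) hrN.le
  rw [intervalIntegral.integral_sub (intervalIntegrable_source hf hvc hr.1)
    (intervalIntegrable_source hf hwc hr.1), sub_zero, abs_of_pos hr0, Real.norm_eq_abs] at h1
  rw [Real.dist_eq]
  unfold sourceMean
  rw [← sub_div, abs_div, abs_of_pos hrN, div_lt_iff₀ hrN]
  have h3 : |-(∫ s in (0 : ℝ)..r, s ^ (N - 1) * f (w s)) -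
      -(∫ s in (0 : ℝ)..r, s ^ (N - 1) * f (v s))| = |(∫ s in (0 : ℝ)..r, s ^ (N - 1) * f (v s)) -
      ∫ s in (0 : ℝ)..r, s ^ (N - 1) * f (w s)| := by ring_nf
  rw [h3]
  refine h1.trans_lt ?_
  have h4 : ε / (|R| + 1) * r < ε := by
    rw [div_mul_eq_mul_div, div_lt_iff₀ (by positivity)]
    have : r < |R| + 1 := by linarith [le_abs_self R, hr.2]
    nlinarith
  calc r ^ (N - 1) * (ε / (|R| + 1)) * r = r ^ (N - 1) * (ε / (|R| + 1) * r) := by ring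
    _ < r ^ (N - 1) * ε := mul_lt_mul_of_pos_left h4 hrN
    _ = ε * r ^ (N - 1) := mul_comm _ _

lemma tendstoUniformlyOn_comp_of_bounded {ι : Type*} {l : Filter ι} [l.NeBot] {g : ℝ → ℝ}
    (hg : Continuous g) {F : ι → ℝ → ℝ} {w : ℝ → ℝ} {s : Set ℝ} {U : ℝ}
    (hF : ∀ᶠ i in l, ∀ r ∈ s, |F i r| ≤ U) (h : TendstoUniformlyOn F w l s) :
    TendstoUniformlyOn (fun i => g ∘ F i) (g ∘ w) l s := by
  have huc : UniformContinuousOn g (Icc (-U) U) :=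
    isCompact_Icc.uniformContinuousOn_of_continuous hg.continuousOn
  have hw : ∀ r ∈ s, w r ∈ Icc (-U) U := fun r hr =>
    isClosed_Icc.mem_of_tendsto (h.tendsto_at hr) (hF.mono fun i hi => abs_le.mp (hi r hr))
  rw [Metric.uniformContinuousOn_iff] at huc
  rw [Metric.tendstoUniformlyOn_iff] at h ⊢
  intro ε hε
  obtain ⟨δ, hδ, hgδ⟩ := huc ε hε
  filter_upwards [h δ hδ, hF] with i hi hFi r hr
  exact hgδ _ (hw r hr) _ (abs_le.mp (hFi r hr)) (hi r hr)

/-- Compactness: along an ultrafilter of solutions whose initial values tend to `lam₀`, the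
solutions converge in `C¹` on bounded intervals to a solution with initial value `lam₀`. -/
theorem exists_limit_solution (hp : 1 < p) (hN : p < N) (hf : Continuous f) (h5 : H5 p f)
    (𝒰 : Ultrafilter (ℝ → ℝ)) (hU : ↑𝒰 ≤ solutionsNear N p f lam₀) :
    ∃ w, IsSolution N p f lam₀ w ∧ ∀ R,
      TendstoUniformlyOn (fun v : ℝ → ℝ => v) w (𝒰 : Filter (ℝ → ℝ)) (Icc 0 R) ∧
      TendstoUniformlyOn rderiv (rderiv w) (𝒰 : Filter (ℝ → ℝ)) (Icc 0 R) := by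
  obtain ⟨U, V, hV, hbd⟩ := exists_C1_bound (N := N) (lam₀ := lam₀) hp hf h5
  replace hbd := hbd.filter_mono hU
  have hsol := (eventually_isSolution (N := N) (p := p) (f := f) (lam₀ := lam₀)).filter_mono hU
  have hpt : ∀ r, 0 ≤ r → ∃ y, Tendsto (fun v : ℝ → ℝ => v r) 𝒰 (𝓝 y) := by
    intro r hr
    obtain ⟨y, -, hy⟩ := (isCompact_Icc (a := -U) (b := U)).ultrafilter_le_nhds
      (𝒰.map fun v => v r) (le_principal_iff.mpr
        (mem_map.mpr (hbd.mono fun v hv => abs_le.mp (hv r hr).1)))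
    exact ⟨y, hy⟩
  choose! w₀ hw₀ using hpt
  -- The even extension makes the limit continuous on the whole line.
  set w : ℝ → ℝ := fun r => w₀ |r| with hwdef
  have hlim : ∀ r, 0 ≤ r → Tendsto (fun v : ℝ → ℝ => v r) 𝒰 (𝓝 (w r)) := by
    intro r hr
    simp only [hwdef, abs_of_nonneg hr]
    exact hw₀ r hr
  have hLip : ∀ᶠ v in (𝒰 : Filter (ℝ → ℝ)), ∀ r, 0 ≤ r → ∀ s, 0 ≤ s →
      |v r - v s| ≤ V * |r - s| := by
    filter_upwards [hbd, hsol] with v hv hs r hr s hs'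
    exact (convex_Ici (0 : ℝ)).norm_image_sub_le_of_norm_hasDerivWithin_le
      (fun x hx => hs.hasDerivWithinAt hx) (fun x hx => (hv x hx).2) hs' hr
  have hwLip : ∀ r, 0 ≤ r → ∀ s, 0 ≤ s → |w r - w s| ≤ V * |r - s| := by
    intro r hr s hs
    refine le_of_tendsto ((hlim r hr).sub (hlim s hs)).abs ?_
    filter_upwards [hLip] with v hv using hv r hr s hs
  have hwc : Continuous w := by
    have : LipschitzWith V.toNNReal w := LipschitzWith.of_dist_le_mul fun r s => by
      rw [Real.dist_eq, Real.dist_eq, Real.coe_toNNReal V hV]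
      have h1 := hwLip |r| (abs_nonneg _) |s| (abs_nonneg _)
      simp only [hwdef, abs_abs] at h1 ⊢
      exact h1.trans (mul_le_mul_of_nonneg_left (abs_abs_sub_abs_le r s) hV)
    exact this.continuous
  have hunif := fun R => tendstoUniformlyOn_of_lipschitz hV hLip hwLip hlim R
  have hvc : ∀ᶠ v in (𝒰 : Filter (ℝ → ℝ)), ContinuousOn v (Ici 0) :=
    hsol.mono fun v hv => hv.continuousOn
  have hQ : ∀ R, TendstoUniformlyOn (fun v : ℝ → ℝ => sourceMean N f v) (sourceMean N f w)
      (𝒰 : Filter (ℝ → ℝ)) (Icc 0 R) := fun R =>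
    tendstoUniformlyOn_sourceMean hf hwc.continuousOn hvc
      (tendstoUniformlyOn_comp_of_bounded hf (F := fun v : ℝ → ℝ => v)
        (hbd.mono fun v hv r hr => (hv r hr.1).1) (hunif R))
  set d : ℝ → ℝ := fun r => phi (p / (p - 1)) (sourceMean N f w r) with hd
  have hdunif : ∀ R, TendstoUniformlyOn rderiv d (𝒰 : Filter (ℝ → ℝ)) (Icc 0 R) := by
    intro R
    have h1 := tendstoUniformlyOn_comp_of_bounded (U := V ^ (p - 1))
      (continuous_phi (one_lt_conj hp)) (by
        filter_upwards [hbd, hsol] with v hv hs r hr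
        rw [← hs.phi_rderiv_eq hp hN hf hr.1, abs_phi hp]
        exact Real.rpow_le_rpow (abs_nonneg _) (hv r hr.1).2 (by linarith)) (hQ R)
    refine h1.congr ?_
    filter_upwards [hsol] with v hs r hr
    rw [Function.comp, ← hs.phi_rderiv_eq hp hN hf hr.1, phi_conj_phi hp]
  have hdc : ContinuousOn d (Ici 0) := by
    intro r hr
    have h1 : ContinuousOn d (Icc 0 (r + 1)) := (hdunif (r + 1)).continuousOn
      (hsol.mono fun v hv => hv.continuousOn_rderiv.mono fun s hs => hs.1).frequently
    have h2 : r ∈ Icc 0 (r + 1) := ⟨hr, by linarith⟩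
    refine (h1 r h2).mono_of_mem_nhdsWithin ?_
    rw [← Ici_inter_Iic]
    exact inter_mem self_mem_nhdsWithin (mem_nhdsWithin_of_mem_nhds (Iic_mem_nhds (by linarith)))
  have hφd : ∀ r, phi p (d r) = sourceMean N f w r := by
    intro r
    have h1 := phi_conj_phi (one_lt_conj hp) (sourceMean N f w r)
    have h2 : p / (p - 1) / (p / (p - 1) - 1) = p := by
      have : p - 1 ≠ 0 := by linarith
      field_simp
      ring
    rwa [h2] at h1
  have hmain := IsSolution.of_hasDerivAt (N := N) (u := w) (d := d) (lam := lam₀) hp hf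
    hwc.continuousWithinAt hdc ?_ ?_ ?_ ?_
  · refine ⟨w, hmain.1, fun R => ⟨hunif R, ?_⟩⟩
    exact (hdunif R).congr_right fun r hr => (hmain.2 r hr.1).symm
  · intro r hr
    refine hasDerivAt_of_tendstoLocallyUniformlyOn (l := (𝒰 : Filter (ℝ → ℝ)))
      (f := fun v : ℝ → ℝ => v) (f' := rderiv) (s := Ioo 0 (r + 1)) isOpen_Ioo
      ((hdunif (r + 1)).mono Ioo_subset_Icc_self).tendstoLocallyUniformlyOn ?_
      (fun x hx => hlim x hx.1.le) ⟨hr, by linarith⟩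
    filter_upwards [hsol] with v hv x hx using hv.hasDerivAt hx.1
  · intro r hr
    have hc : Continuous fun s => s ^ (N - 1) * f (w s) :=
      (continuous_pow _).mul (hf.comp hwc)
    have h1 := (intervalIntegral.integral_hasDerivAt_right (hc.intervalIntegrable 0 r)
      (hc.stronglyMeasurableAtFilter _ _) hc.continuousAt).neg
    refine h1.congr_of_eventuallyEq ?_
    filter_upwards [Ioi_mem_nhds hr] with s hs
    rw [hφd, sourceMean]
    have : s ^ (N - 1) ≠ 0 := pow_ne_zero _ (ne_of_gt hs)
    simp only [Pi.neg_apply]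
    field_simp
  · exact tendsto_nhds_unique (hlim 0 le_rfl) (tendsto_initial_value.mono_left hU)
  · simp [hd, sourceMean, phi_zero]

end Compactness

/-! ### Stability of simple zeros -/

lemma eventually_mul_sub_pos {g : ℝ → ℝ} {c z : ℝ} (hg : HasDerivAt g c z) (hz : g z = 0)
    (hc : c ≠ 0) : ∀ᶠ x in 𝓝[≠] z, 0 < c * g x * (x - z) := by
  have h1 : Tendsto (fun x => c * slope g z x) (𝓝[≠] z) (𝓝 (c * c)) :=
    (hasDerivAt_iff_tendsto_slope.mp hg).const_mul c
  filter_upwards [h1.eventually_const_lt (mul_self_pos.mpr hc), self_mem_nhdsWithin] with x hx hne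
  have hxz : x - z ≠ 0 := sub_ne_zero.mpr hne
  rw [slope_def_field, hz, sub_zero] at hx
  have h2 : c * g x * (x - z) = c * (g x / (x - z)) * ((x - z) * (x - z)) := by
    field_simp
  rw [h2]
  exact mul_pos hx (mul_self_pos.mpr hxz)

section Counting

variable {ι : Type*} {l : Filter ι} {F F' : ι → ℝ → ℝ} {w w' : ℝ → ℝ} {R : ℝ}

/-- Near a simple zero of the limit `w`, the functions `F i` have exactly one zero eventually. -/
lemma exists_unique_zero_near (hw'c : ContinuousOn w' (Icc 0 R))
    (hwd : ∀ r ∈ Ioo 0 R, HasDerivAt w (w' r) r)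
    (hF : ∀ᶠ i in l, ContinuousOn (F i) (Icc 0 R) ∧ ∀ r ∈ Ioo 0 R, HasDerivAt (F i) (F' i r) r)
    (hu : TendstoUniformlyOn F w l (Icc 0 R)) (hu' : TendstoUniformlyOn F' w' l (Icc 0 R))
    {z : ℝ} (hz : z ∈ Ioo 0 R) (hwz : w z = 0) (hwz' : w' z ≠ 0) {O : Set ℝ} (hO : O ∈ 𝓝 z) :
    ∃ δ, 0 < δ ∧ Icc (z - δ) (z + δ) ⊆ O ∩ Ioo 0 R ∧ ∀ᶠ i in l,
      (∃ y ∈ Ioo (z - δ) (z + δ), F i y = 0 ∧ ∀ y' ∈ Icc (z - δ) (z + δ), F i y' = 0 → y' = y) ∧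
      ∀ y ∈ Icc (z - δ) (z + δ), F' i y ≠ 0 := by
  set c := w' z with hcdef
  have e1 : ∀ᶠ x in 𝓝 z, c * c / 2 < c * w' x := by
    have h1 : ContinuousAt (fun x => c * w' x) z :=
      continuousAt_const.mul (hw'c.continuousAt (Icc_mem_nhds hz.1 hz.2))
    exact h1.eventually_const_lt (half_lt_self (mul_self_pos.mpr hwz'))
  have e2 : ∀ᶠ x in 𝓝 z, x ≠ z → 0 < c * w x * (x - z) :=
    eventually_nhdsWithin_iff.mp (eventually_mul_sub_pos (hwd z hz) hwz hwz')
  obtain ⟨ε, hε, hball⟩ := Metric.eventually_nhds_iff.mp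
    ((e1.and e2).and ((eventually_mem_set.mpr hO).and (Ioo_mem_nhds hz.1 hz.2)))
  have hI : ∀ x ∈ Icc (z - ε / 2) (z + ε / 2), dist x z < ε := fun x hx => by
    rw [Real.dist_eq, abs_lt]
    constructor <;> linarith [hx.1, hx.2]
  have hsub : Icc (z - ε / 2) (z + ε / 2) ⊆ O ∩ Ioo 0 R := fun x hx => (hball (hI x hx)).2
  refine ⟨ε / 2, by positivity, hsub, ?_⟩
  have hl : z - ε / 2 ∈ Icc (z - ε / 2) (z + ε / 2) := ⟨le_rfl, by linarith⟩
  have hr : z + ε / 2 ∈ Icc (z - ε / 2) (z + ε / 2) := ⟨by linarith, le_rfl⟩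
  have hwl : c * w (z - ε / 2) < 0 := by
    have := (hball (hI _ hl)).1.2 (by linarith)
    nlinarith
  have hwr : 0 < c * w (z + ε / 2) := by
    have := (hball (hI _ hr)).1.2 (by linarith)
    nlinarith
  have hFl := ((hu.tendsto_at (Ioo_subset_Icc_self (hsub hl).2)).const_mul c).eventually_lt_const
    hwl
  have hFr := ((hu.tendsto_at (Ioo_subset_Icc_self (hsub hr).2)).const_mul c).eventually_const_lt
    hwr
  filter_upwards [hF, hFl, hFr, Metric.tendstoUniformlyOn_iff.mp hu' (|c| / 2)
    (half_pos (abs_pos.mpr hwz'))] with i hi hil hir hi'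
  have hne : ∀ y ∈ Icc (z - ε / 2) (z + ε / 2), F' i y ≠ 0 := by
    intro y hy h0
    have h1 := (hball (hI y hy)).1.1
    have h2 := hi' y (Ioo_subset_Icc_self (hsub hy).2)
    rw [h0, dist_zero_right, Real.norm_eq_abs] at h2
    have h3 : c * w' y ≤ |c| * |w' y| := by rw [← abs_mul]; exact le_abs_self _
    have h4 : |c| * |c| = c * c := abs_mul_abs_self c
    have h5 := abs_pos.mpr hwz'
    nlinarith
  have hcI : ContinuousOn (F i) (Icc (z - ε / 2) (z + ε / 2)) :=
    hi.1.mono fun x hx => Ioo_subset_Icc_self (hsub hx).2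
  have hinj := injOn_of_deriv_ne_zero hcI
    (fun x hx => hi.2 x (hsub (Ioo_subset_Icc_self hx)).2)
    fun x hx => hne x (Ioo_subset_Icc_self hx)
  refine ⟨?_, hne⟩
  obtain ⟨y, hy, hy0⟩ := intermediate_value_Ioo (by linarith : z - ε / 2 ≤ z + ε / 2)
    (continuousOn_const.mul hcI : ContinuousOn (fun x => c * F i x) _) ⟨hil, hir⟩
  have hFy : F i y = 0 := (mul_eq_zero.mp hy0).resolve_left hwz'
  exact ⟨y, hy, hFy, fun y' hy' h0 => hinj hy' (Ioo_subset_Icc_self hy) (h0.trans hFy.symm)⟩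

lemma finite_zeros (hwc : ContinuousOn w (Icc 0 R)) (hwd : ∀ r ∈ Ioo 0 R, HasDerivAt w (w' r) r)
    (h0 : w 0 ≠ 0) (hR : w R ≠ 0) (hs : ∀ r ∈ Icc 0 R, w r = 0 → w' r ≠ 0) :
    {r ∈ Icc 0 R | w r = 0}.Finite := by
  by_contra hinf
  have hK : IsCompact {r ∈ Icc 0 R | w r = 0} :=
    isCompact_Icc.of_isClosed_subset
      (isClosed_Icc.isClosed_eq hwc continuousOn_const) fun r hr => hr.1
  obtain ⟨z, hz, hacc⟩ := Set.Infinite.exists_accPt_of_subset_isCompact hinf hK Subset.rfl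
  have hzI : z ∈ Ioo 0 R := by
    refine ⟨lt_of_le_of_ne hz.1.1 ?_, lt_of_le_of_ne hz.1.2 ?_⟩
    · rintro rfl; exact h0 hz.2
    · rintro rfl; exact hR hz.2
  have h1 := eventually_mul_sub_pos (hwd z hzI) hz.2 (hs z hz.1 hz.2)
  rw [accPt_iff_frequently_nhdsNE] at hacc
  obtain ⟨x, hx, hx2⟩ := (hacc.and_eventually h1).exists
  rw [hx.2, mul_zero, zero_mul] at hx2
  exact lt_irrefl _ hx2

/-- Under `C¹` convergence on `[0, R]` to a function with simple zeros, all of them interior, the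
number of zeros is eventually constant and the zeros are eventually simple. -/
theorem eventually_encard_zeros_eq (hwc : ContinuousOn w (Icc 0 R))
    (hw'c : ContinuousOn w' (Icc 0 R)) (hwd : ∀ r ∈ Ioo 0 R, HasDerivAt w (w' r) r)
    (h0 : w 0 ≠ 0) (hR : w R ≠ 0) (hs : ∀ r ∈ Icc 0 R, w r = 0 → w' r ≠ 0)
    (hF : ∀ᶠ i in l, ContinuousOn (F i) (Icc 0 R) ∧ ∀ r ∈ Ioo 0 R, HasDerivAt (F i) (F' i r) r)
    (hu : TendstoUniformlyOn F w l (Icc 0 R)) (hu' : TendstoUniformlyOn F' w' l (Icc 0 R)) :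
    ∀ᶠ i in l, {r ∈ Icc 0 R | F i r = 0}.encard = {r ∈ Icc 0 R | w r = 0}.encard ∧
      ∀ r ∈ Icc 0 R, F i r = 0 → F' i r ≠ 0 := by
  have hfin := finite_zeros hwc hwd h0 hR hs
  set Z := {r ∈ Icc 0 R | w r = 0} with hZ
  obtain ⟨O, hO, hdisj⟩ := hfin.t2_separation
  have hloc : ∀ z, z ∈ Z → ∃ δ, 0 < δ ∧ Icc (z - δ) (z + δ) ⊆ O z ∩ Ioo 0 R ∧ ∀ᶠ i in l,
      (∃ y ∈ Ioo (z - δ) (z + δ), F i y = 0 ∧ ∀ y' ∈ Icc (z - δ) (z + δ), F i y' = 0 → y' = y) ∧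
      ∀ y ∈ Icc (z - δ) (z + δ), F' i y ≠ 0 := by
    intro z hz
    have hzI : z ∈ Ioo 0 R := by
      refine ⟨lt_of_le_of_ne hz.1.1 ?_, lt_of_le_of_ne hz.1.2 ?_⟩
      · rintro rfl; exact h0 hz.2
      · rintro rfl; exact hR hz.2
    exact exists_unique_zero_near hw'c hwd hF hu hu' hzI hz.2 (hs z hz.1 hz.2)
      ((hO z).2.mem_nhds (hO z).1)
  choose! δ hδ hδsub hδev using hloc
  set K := Icc 0 R \ ⋃ z ∈ Z, Ioo (z - δ z) (z + δ z) with hK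
  have hKc : IsCompact K :=
    isCompact_Icc.diff (isOpen_biUnion fun z _ => isOpen_Ioo)
  obtain ⟨m, hm, hmK⟩ := hKc.exists_forall_le' (f := fun r => |w r|)
    (hwc.abs.mono sdiff_subset) (a := 0) fun x hx => by
      refine abs_pos.mpr fun hx0 => hx.2 (mem_biUnion (⟨hx.1, hx0⟩ : x ∈ Z) ?_)
      have := hδ x ⟨hx.1, hx0⟩
      exact ⟨by linarith, by linarith⟩
  filter_upwards [(eventually_all_finite hfin).mpr hδev,
    Metric.tendstoUniformlyOn_iff.mp hu m hm] with i hi hclose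
  have hcover : ∀ r ∈ Icc 0 R, F i r = 0 → ∃ z ∈ Z, r ∈ Ioo (z - δ z) (z + δ z) := by
    intro r hr h0
    by_contra hno
    have hrK : r ∈ K := ⟨hr, fun hmem => hno (by
      obtain ⟨z, hz, hrz⟩ := mem_iUnion₂.mp hmem
      exact ⟨z, hz, hrz⟩)⟩
    have h1 := hclose r hr
    rw [h0, dist_zero_right, Real.norm_eq_abs] at h1
    exact absurd (hmK r hrK) (not_le.mpr h1)
  refine ⟨?_, fun r hr hr0 => ?_⟩
  · choose! g hgmem hg0 hguniq using fun z hz => (hi z hz).1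
    have hinj : InjOn g Z := by
      intro z hz z' hz' he
      by_contra hne
      have h1 := (hδsub z hz (Ioo_subset_Icc_self (hgmem z hz))).1
      have h2 := (hδsub z' hz' (Ioo_subset_Icc_self (hgmem z' hz'))).1
      rw [← he] at h2
      exact disjoint_left.mp (hdisj hz hz' hne) h1 h2
    rw [← hinj.encard_image]
    congr 1
    ext r
    constructor
    · rintro ⟨hr, hr0⟩
      obtain ⟨z, hz, hrz⟩ := hcover r hr hr0
      exact ⟨z, hz, (hguniq z hz r (Ioo_subset_Icc_self hrz) hr0).symm⟩
    · rintro ⟨z, hz, rfl⟩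
      exact ⟨Ioo_subset_Icc_self (hδsub z hz (Ioo_subset_Icc_self (hgmem z hz))).2, hg0 z hz⟩
  · obtain ⟨z, hz, hrz⟩ := hcover r hr hr0
    exact (hi z hz).2 r (Ioo_subset_Icc_self hrz)

end Counting

/-! ### Nodes -/

section Nodes

variable {N : ℕ} {p : ℝ} {f : ℝ → ℝ} {lam : ℝ} {u : ℝ → ℝ} {β : ℝ}

lemma mem_nodes_of_hasDerivAt {r d : ℝ} (hr : 0 < r) (hu : HasDerivAt u d r) (h0 : u r = 0)
    (hd : d ≠ 0) : r ∈ nodes u := by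
  have h1 := eventually_mul_sub_pos hu h0 hd
  refine ⟨hr, h0, ?_, ?_⟩
  · rw [mem_interior_iff_mem_nhds]
    have h2 : ∀ᶠ x in 𝓝[≠] r, x ∈ {r : ℝ | 0 ≤ r ∧ u r ≠ 0} := by
      filter_upwards [h1, nhdsWithin_le_nhds (Ioi_mem_nhds hr)] with x hx hx0
      refine ⟨le_of_lt hx0, fun h => ?_⟩
      rw [h, mul_zero, zero_mul] at hx
      exact lt_irrefl _ hx
    have h3 : r ∈ radialSupport u :=
      mem_closure_iff_frequently.mpr (h2.frequently.filter_mono nhdsWithin_le_nhds)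
    filter_upwards [eventually_nhdsWithin_iff.mp h2] with x hx
    rcases eq_or_ne x r with rfl | hne
    · exact h3
    · exact subset_closure (hx hne)
  · have hl : ∀ᶠ x in 𝓝[<] r, d * u x < 0 := by
      filter_upwards [h1.filter_mono (nhdsLT_le_nhdsNE r), self_mem_nhdsWithin] with x hx hlt
      have : x - r < 0 := sub_neg.mpr hlt
      nlinarith
    have hr' : ∀ᶠ x in 𝓝[>] r, 0 < d * u x := by
      filter_upwards [h1.filter_mono (nhdsGT_le_nhdsNE r), self_mem_nhdsWithin] with x hx hlt
      have : 0 < x - r := sub_pos.mpr hlt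
      nlinarith
    rcases lt_or_gt_of_ne hd with hd | hd
    · exact Or.inl ⟨hl.mono fun x hx => by nlinarith, hr'.mono fun x hx => by nlinarith⟩
    · exact Or.inr ⟨hl.mono fun x hx => by nlinarith, hr'.mono fun x hx => by nlinarith⟩

lemma IsSolution.nodes_inter_Iic (h : IsSolution N p f lam u) (hlam : lam ≠ 0) {R : ℝ}
    (hs : ∀ r ∈ Icc 0 R, u r = 0 → rderiv u r ≠ 0) :
    nodes u ∩ Iic R = {r ∈ Icc 0 R | u r = 0} := by
  ext r
  constructor
  · rintro ⟨hr, hrR⟩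
    exact ⟨⟨hr.1.le, hrR⟩, hr.2.1⟩
  · rintro ⟨hr, hr0⟩
    have hpos : 0 < r := lt_of_le_of_ne hr.1 (by
      rintro rfl; exact hlam (h.initial_value ▸ hr0))
    exact ⟨mem_nodes_of_hasDerivAt hpos (h.hasDerivAt hpos) hr0 (hs r hr hr0), hr.2⟩

/-- The energy is positive before a node. -/
lemma IsSolution.energy_pos_of_mem_nodes (hp : 1 < p) (hN : p < N) (hf : Continuous f)
    (h : IsSolution N p f lam u) {s r : ℝ} (hs : s ∈ nodes u) (hr0 : 0 ≤ r) (hrs : r < s) :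
    0 < energy p f u r := by
  by_contra hcon
  push Not at hcon
  have h1 : 0 ≤ energy p f u s := by
    have := primitive_le_energy (f := f) (u := u) hp s
    rwa [hs.2.1, primitive_zero] at this
  have h2 := h.antitoneOn_energy hp hf hr0 (hr0.trans hrs.le) hrs.le
  have he : energy p f u s = energy p f u r := by linarith
  have hz : ∀ᶠ x in 𝓝[<] s, u x = 0 := by
    filter_upwards [Ioo_mem_nhdsLT hrs] with x hx
    rw [h.eq_of_energy_eq hp hN hf hr0 he (Ioo_subset_Icc_self hx),
      ← h.eq_of_energy_eq hp hN hf hr0 he (right_mem_Icc.mpr hrs.le), hs.2.1]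
  rcases hs.2.2.2 with hc | hc
  · obtain ⟨x, hx1, hx2⟩ := (hz.and hc.1).exists
    exact hx2.ne' hx1
  · obtain ⟨x, hx1, hx2⟩ := (hz.and hc.1).exists
    exact hx2.ne hx1

/-- A solution that starts at `r₁ ≤ R₀` inside the half well with little energy has at most one
later node: to come back to `0` it would have to leave the well, and crossing the region
`β/2 ≤ |x| ≤ β` within the bounded transit time costs a fixed amount of energy. -/
lemma IsWell.exists_nodes_subsingleton (hp : 1 < p) (hN : p < N) (hf : Continuous f)
    (hw : IsWell p f β) {R₀ : ℝ} (hR₀ : 0 ≤ R₀) :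
    ∃ ε, 0 < ε ∧ ∀ (lam : ℝ) (v : ℝ → ℝ), IsSolution N p f lam v → ∀ r₁, 0 ≤ r₁ → r₁ ≤ R₀ →
      |v r₁| ≤ β / 2 → energy p f v r₁ < ε → (nodes v ∩ Ioi r₁).Subsingleton := by
  have hβ := hw.pos
  have hT := transitTime_nonneg p f β
  obtain ⟨m, hm, hmK⟩ : ∃ m, 0 < m ∧ ∀ x, β / 2 ≤ |x| → |x| ≤ β → m ≤ -primitive f x := by
    have hK : IsCompact {x : ℝ | β / 2 ≤ |x| ∧ |x| ≤ β} := by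
      refine (isCompact_Icc (a := -β) (b := β)).of_isClosed_subset ?_
        fun x hx => abs_le.mp hx.2
      exact (isClosed_le continuous_const continuous_abs).inter
        (isClosed_le continuous_abs continuous_const)
    obtain ⟨m, hm, hm'⟩ := hK.exists_forall_le' (continuous_primitive hf).neg.continuousOn
      (a := 0) fun x hx => neg_pos.mpr (hw.neg x
        (abs_pos.mp ((half_pos hβ).trans_le hx.1)) (hx.2.trans (by linarith)))
    exact ⟨m, hm, fun x hx1 hx2 => hm' x ⟨hx1, hx2⟩⟩
  set S := R₀ + 2 * transitTime p f β + 1 with hS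
  have hS0 : 0 < S := by positivity
  refine ⟨β / 2 * (m ^ ((p - 1) / p) / S), by positivity, fun lam v h r₁ hr₁ hr₁R hv hE => ?_⟩
  have hcts : ∀ {a b : ℝ}, r₁ ≤ a → ContinuousOn v (Icc a b) := fun ha =>
    h.continuousOn.mono fun s hs => hr₁.trans (ha.trans hs.1)
  have hstay : ∀ s ∈ nodes v, r₁ < s → ∀ r ∈ Icc r₁ s, |v r| ≤ β := by
    intro s hs hrs r hr
    by_contra hbig
    push Not at hbig
    -- `t₂` is the first time with `|v| = β`, and `t₁` the last time before with `|v| = β/2`.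
    obtain ⟨t₂, ht₂, hleast⟩ : ∃ t₂, IsLeast {t ∈ Icc r₁ s | |v t| = β} t₂ := by
      refine IsCompact.exists_isLeast (isCompact_Icc.of_isClosed_subset
        (isClosed_Icc.isClosed_eq (hcts le_rfl).abs continuousOn_const) fun t ht => ht.1) ?_
      obtain ⟨t, ht, hte⟩ := intermediate_value_Icc hr.1 (hcts le_rfl).abs
        (⟨by linarith, hbig.le⟩ : β ∈ Icc |v r₁| |v r|)
      exact ⟨t, ⟨ht.1, ht.2.trans hr.2⟩, hte⟩
    have hle : ∀ t ∈ Icc r₁ t₂, |v t| ≤ β := by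
      intro t ht
      by_contra hcon
      push Not at hcon
      obtain ⟨x, hx, hxe⟩ := intermediate_value_Icc ht.1 (hcts le_rfl).abs
        (⟨by linarith, hcon.le⟩ : β ∈ Icc |v r₁| |v t|)
      have hxt : t₂ ≤ x := hleast ⟨⟨hx.1, hx.2.trans (ht.2.trans ht₂.1.2)⟩, hxe⟩
      have : t = t₂ := le_antisymm ht.2 (hxt.trans hx.2)
      rw [this, ht₂.2] at hcon
      exact lt_irrefl _ hcon
    obtain ⟨t₁, ht₁, hgreatest⟩ : ∃ t₁, IsGreatest {t ∈ Icc r₁ t₂ | |v t| = β / 2} t₁ := by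
      refine IsCompact.exists_isGreatest (isCompact_Icc.of_isClosed_subset
        (isClosed_Icc.isClosed_eq (hcts le_rfl).abs continuousOn_const) fun t ht => ht.1) ?_
      obtain ⟨t, ht, hte⟩ := intermediate_value_Icc ht₂.1.1 (hcts le_rfl).abs
        (⟨hv, by rw [ht₂.2]; linarith⟩ : β / 2 ∈ Icc |v r₁| |v t₂|)
      exact ⟨t, ht, hte⟩
    have hge : ∀ t ∈ Icc t₁ t₂, β / 2 ≤ |v t| := by
      intro t ht
      by_contra hcon
      push Not at hcon
      obtain ⟨x, hx, hxe⟩ := intermediate_value_Icc ht.2 (hcts (ht₁.1.1.trans ht.1)).abs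
        (⟨hcon.le, by rw [ht₂.2]; linarith⟩ : β / 2 ∈ Icc |v t| |v t₂|)
      have hxt : x ≤ t₁ := hgreatest ⟨⟨ht₁.1.1.trans (ht.1.trans hx.1), hx.2⟩, hxe⟩
      have : t = t₁ := le_antisymm (hx.1.trans hxt) ht.1
      rw [this, ht₁.2] at hcon
      exact lt_irrefl _ hcon
    have hlt : t₁ < t₂ := by
      refine lt_of_le_of_ne ht₁.1.2 fun he => ?_
      have := ht₁.2
      rw [he, ht₂.2] at this
      linarith
    have hEpos : ∀ t, r₁ ≤ t → t < t₂ → 0 < energy p f v t := fun t ht1 ht2 =>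
      h.energy_pos_of_mem_nodes hp hN hf hs (hr₁.trans ht1) (ht2.trans_le ht₂.1.2)
    have htime := h.sub_le_well hp hf hw hr₁ ht₂.1.1 hle fun t ht => hEpos t ht.1.le ht.2
    obtain ⟨c, hc, hce⟩ := exists_ratio_hasDerivAt_eq_ratio_slope (energy p f v)
      (fun r => -(((N - 1 : ℕ) : ℝ) / r * |rderiv v r| ^ p)) hlt
      ((h.continuousOn_energy hp hf).mono fun t ht => hr₁.trans (ht₁.1.1.trans ht.1))
      (fun t ht => h.hasDerivAt_energy hp hf (hr₁.trans_lt (ht₁.1.1.trans_lt ht.1)))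
      v (rderiv v) (hcts ht₁.1.1)
      (fun t ht => h.hasDerivAt (hr₁.trans_lt (ht₁.1.1.trans_lt ht.1)))
    have hcI := Ioo_subset_Icc_self hc
    have hc0 : 0 < c := hr₁.trans_lt (ht₁.1.1.trans_lt hc.1)
    have hcE := hEpos c (ht₁.1.1.trans hc.1.le) hc.2
    have hmd : m ≤ |rderiv v c| ^ p := by
      have h1 := le_abs_rderiv_rpow (f := f) (u := v) hp c
      have h2 := hmK (v c) (hge c hcI) (hle c ⟨ht₁.1.1.trans hc.1.le, hc.2.le⟩)
      linarith
    have hd0 : 0 < |rderiv v c| := by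
      refine abs_pos.mpr fun h0 => ?_
      rw [h0, abs_zero, Real.zero_rpow (by linarith)] at hmd
      linarith
    have hmd' : m ^ ((p - 1) / p) ≤ |rderiv v c| ^ (p - 1) := by
      have h1 := Real.rpow_le_rpow hm.le hmd (z := (p - 1) / p)
        (div_nonneg (by linarith) (by linarith))
      rwa [← Real.rpow_mul (abs_nonneg _), mul_div_cancel₀ _ (by linarith : p ≠ 0)] at h1
    have hdp : |rderiv v c| ^ p = |rderiv v c| ^ (p - 1) * |rderiv v c| := by
      rw [← Real.rpow_add_one hd0.ne']; congr 1; ring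
    have hrate : m ^ ((p - 1) / p) / S ≤ ((N - 1 : ℕ) : ℝ) / c * |rderiv v c| ^ (p - 1) := by
      rw [div_eq_mul_one_div, mul_comm]
      refine mul_le_mul ?_ hmd' (Real.rpow_nonneg hm.le _) (by positivity)
      exact div_le_div₀ (Nat.cast_nonneg _) (one_le_cast_sub_one hp hN) hc0 (by linarith [hc.2])
    have hgap : β / 2 ≤ |v t₂ - v t₁| := by
      have := abs_sub_abs_le_abs_sub (v t₂) (v t₁)
      rw [ht₂.2, ht₁.2] at this
      linarith
    have habs : |v t₂ - v t₁| * (((N - 1 : ℕ) : ℝ) / c * |rderiv v c| ^ (p - 1)) =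
        |energy p f v t₂ - energy p f v t₁| := by
      have h1 := congrArg abs hce
      rw [abs_mul, abs_mul, abs_neg, abs_of_nonneg (mul_nonneg (div_nonneg (Nat.cast_nonneg _)
        hc0.le) (Real.rpow_nonneg (abs_nonneg _) _)), hdp, ← mul_assoc, ← mul_assoc] at h1
      rw [← mul_assoc]
      exact mul_right_cancel₀ hd0.ne' h1
    have hloss : β / 2 * (m ^ ((p - 1) / p) / S) ≤ |energy p f v t₂ - energy p f v t₁| := by
      rw [← habs]
      exact mul_le_mul hgap hrate (by positivity) (abs_nonneg _)
    have hanti := h.antitoneOn_energy hp hf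
    have h1 := hanti (hr₁.trans ht₁.1.1) (hr₁.trans ht₂.1.1) hlt.le
    have h2 := hanti hr₁ (hr₁.trans ht₁.1.1) ht₁.1.1
    have h3 : 0 ≤ energy p f v t₂ := by
      have h5 := hanti (hr₁.trans ht₂.1.1) (hr₁.trans hrs.le) ht₂.1.2
      have h6 := primitive_le_energy (f := f) (u := v) hp s
      rw [hs.2.1, primitive_zero] at h6
      linarith
    rw [abs_of_nonpos (by linarith)] at hloss
    linarith
  have key : ∀ s ∈ nodes v ∩ Ioi r₁, ∀ s' ∈ nodes v ∩ Ioi r₁, s ≤ s' → s = s' := by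
    intro s hs s' hs' hss
    have hinj := h.injOn_well hp hw hr₁ (hstay s' hs'.1 hs'.2) fun t ht =>
      h.energy_pos_of_mem_nodes hp hN hf hs'.1 (hr₁.trans ht.1.le) ht.2
    exact hinj ⟨le_of_lt hs.2, hss⟩ ⟨le_of_lt hs'.2, le_rfl⟩ (hs.1.2.1.trans hs'.1.2.1.symm)
  intro s hs s' hs'
  rcases le_total s s' with hle | hle
  · exact key s hs s' hs' hle
  · exact (key s' hs' s hs hle).symm

end Nodes

/-! ### Truncation at a double zero -/

section Truncation

variable {N : ℕ} {p : ℝ} {f : ℝ → ℝ} {lam : ℝ} {u : ℝ → ℝ}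

lemma hasDerivAt_ite_lt_zero {g : ℝ → ℝ} {x : ℝ} (hg : HasDerivAt g 0 x) (h0 : g x = 0) :
    HasDerivAt (fun r => if r < x then g r else 0) 0 x := by
  rw [hasDerivAt_iff_isLittleO] at hg ⊢
  simp only [h0, lt_irrefl, if_false, sub_zero, smul_zero] at hg ⊢
  refine (Asymptotics.IsBigO.of_bound 1 (Eventually.of_forall fun r => ?_)).trans_isLittleO hg
  split_ifs
  · rw [one_mul]
  · rw [norm_zero, one_mul]; exact norm_nonneg _

lemma hasDerivAt_ite_lt {g : ℝ → ℝ} {g' x r : ℝ} (hrx : r < x) (hg : HasDerivAt g g' r) :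
    HasDerivAt (fun r => if r < x then g r else 0) g' r := by
  refine hg.congr_of_eventuallyEq ?_
  filter_upwards [Iio_mem_nhds hrx] with s hs
  exact if_pos hs

lemma hasDerivAt_ite_gt {g : ℝ → ℝ} {x r : ℝ} (hrx : x < r) :
    HasDerivAt (fun r => if r < x then g r else 0) 0 r := by
  refine (hasDerivAt_const r (0 : ℝ)).congr_of_eventuallyEq ?_
  filter_upwards [Ioi_mem_nhds hrx] with s hs
  exact if_neg (not_lt.mpr (le_of_lt hs))

/-- Cutting off a solution at a point where `u = u' = 0` gives a compactly supported solution. -/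
lemma IsSolution.exists_compactSupport (hp : 1 < p) (h1 : H1 f)
    (h : IsSolution N p f lam u) {r₀ : ℝ} (hr₀ : 0 < r₀) (hu : u r₀ = 0)
    (hd : rderiv u r₀ = 0) :
    ∃ w, IsSolution N p f lam w ∧ IsCompact (radialSupport w) := by
  have hflux : (fun s => s ^ (N - 1) * phi p (if s < r₀ then rderiv u s else 0)) =
      fun s => if s < r₀ then s ^ (N - 1) * phi p (rderiv u s) else 0 := by
    ext s
    split_ifs
    · rfl
    · rw [phi_zero, mul_zero]
  have hsol := IsSolution.of_hasDerivAt (N := N) (lam := lam)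
    (u := fun r => if r < r₀ then u r else 0)
    (d := fun r => if r < r₀ then rderiv u r else 0) hp h1.1 ?_ ?_ ?_ ?_ ?_ ?_
  · refine ⟨_, hsol.1, (isCompact_Icc (a := 0) (b := r₀)).of_isClosed_subset isClosed_closure ?_⟩
    refine closure_minimal (fun r hr => ⟨hr.1, ?_⟩) isClosed_Icc
    by_contra hcon
    exact hr.2 (if_neg (by linarith [not_le.mp hcon]))
  · refine (h.continuousOn 0 self_mem_Ici).congr_of_eventuallyEq ?_ (if_pos hr₀)
    filter_upwards [mem_nhdsWithin_of_mem_nhds (Iio_mem_nhds hr₀)] with s hs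
    exact if_pos hs
  · have : (fun r => if r < r₀ then rderiv u r else 0) = fun r => rderiv u (min r r₀) := by
      ext r
      split_ifs with hr
      · rw [min_eq_left hr.le]
      · rw [min_eq_right (not_lt.mp hr), hd]
    rw [this]
    exact h.continuousOn_rderiv.comp (continuous_id.min continuous_const).continuousOn
      fun r hr => le_min hr hr₀.le
  · intro r hr
    rcases lt_trichotomy r r₀ with hlt | rfl | hgt
    · simp only [if_pos hlt]
      exact hasDerivAt_ite_lt hlt (h.hasDerivAt hr)
    · simp only [lt_irrefl, if_false]
      exact hasDerivAt_ite_lt_zero (hd ▸ h.hasDerivAt hr) hu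
    · simp only [if_neg hgt.not_gt]
      exact hasDerivAt_ite_gt hgt
  · intro r hr
    rw [hflux]
    rcases lt_trichotomy r r₀ with hlt | rfl | hgt
    · simp only [if_pos hlt]
      exact hasDerivAt_ite_lt hlt (h.hasDerivAt_flux hr)
    · simp only [lt_irrefl, if_false, h1.2.2, mul_zero, neg_zero]
      have h2 := h.hasDerivAt_flux hr
      rw [hu, h1.2.2, mul_zero, neg_zero] at h2
      exact hasDerivAt_ite_lt_zero h2 (by rw [hd, phi_zero, mul_zero])
    · simp only [if_neg hgt.not_gt, h1.2.2, mul_zero, neg_zero]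
      exact hasDerivAt_ite_gt hgt
  · simp only [if_pos hr₀, h.initial_value]
  · simp only [if_pos hr₀, h.initial_deriv]

end Truncation

/-! ### Counting the nodes of nearby solutions -/

section Main

variable {N : ℕ} {p : ℝ} {f : ℝ → ℝ} {lam₀ : ℝ} {u w : ℝ → ℝ} {β : ℝ}

/-- The first time at which the energy is nonpositive. -/
lemma IsSolution.exists_first_energy_nonpos (hp : 1 < p) (hN : p < N) (hf : Continuous f)
    (h4 : H4 f) (h5 : H5 p f) (hw : IsWell p f β) (h : IsSolution N p f lam₀ u) :
    ∃ r₀, 0 ≤ r₀ ∧ energy p f u r₀ ≤ 0 ∧ ∀ r ∈ Ico 0 r₀, 0 < energy p f u r := by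
  obtain ⟨R, hR, hER⟩ := h.exists_energy_nonpos hp hN hf h4 h5 hw
  have hcl : IsClosed {r ∈ Icc 0 R | energy p f u r ≤ 0} :=
    isClosed_Icc.isClosed_le ((h.continuousOn_energy hp hf).mono fun r hr => hr.1)
      continuousOn_const
  obtain ⟨r₀, hr₀, hle⟩ := (isCompact_Icc.of_isClosed_subset hcl fun r hr => hr.1).exists_isLeast
    ⟨R, ⟨hR, le_rfl⟩, hER⟩
  refine ⟨r₀, hr₀.1.1, hr₀.2, fun r hr => ?_⟩
  by_contra hcon
  exact absurd (hle ⟨⟨hr.1, hr.2.le.trans hr₀.1.2⟩, not_lt.mp hcon⟩) (not_le.mpr hr.2)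

lemma rderiv_ne_zero_of_energy_pos (hp : 1 < p) {r : ℝ} (h0 : u r = 0)
    (hE : 0 < energy p f u r) : rderiv u r ≠ 0 :=
  rderiv_ne_zero_of_primitive_lt (f := f) hp (by rwa [h0, primitive_zero])

lemma ne_zero_of_energy_neg (hp : 1 < p) {r : ℝ} (hE : energy p f u r < 0) : u r ≠ 0 := by
  intro h0
  have := primitive_le_energy (f := f) (u := u) hp r
  rw [h0, primitive_zero] at this
  linarith

lemma tendsto_energy (hp : 1 < p) (hf : Continuous f) {l : Filter (ℝ → ℝ)} {r : ℝ}
    (h1 : Tendsto (fun v : ℝ → ℝ => v r) l (𝓝 (w r)))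
    (h2 : Tendsto (fun v : ℝ → ℝ => rderiv v r) l (𝓝 (rderiv w r))) :
    Tendsto (fun v => energy p f v r) l (𝓝 (energy p f w r)) :=
  ((h2.abs.rpow_const (Or.inr (by linarith))).const_mul _).add
    (((continuous_primitive hf).tendsto _).comp h1)

/-- The number of nodes in `[0, R]` is stable under `C¹` convergence of solutions when the limit has
only simple zeros there. -/
lemma IsSolution.eventually_encard_nodes (hlam : 0 < lam₀) {l : Filter (ℝ → ℝ)}
    (hl : l ≤ solutionsNear N p f lam₀) (hw : IsSolution N p f lam₀ w) {R : ℝ}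
    (hu : TendstoUniformlyOn (fun v : ℝ → ℝ => v) w l (Icc 0 R))
    (hu' : TendstoUniformlyOn rderiv (rderiv w) l (Icc 0 R)) (hR : w R ≠ 0)
    (hs : ∀ r ∈ Icc 0 R, w r = 0 → rderiv w r ≠ 0) :
    ∀ᶠ v in l, (nodes v ∩ Iic R).encard = {r ∈ Icc 0 R | w r = 0}.encard := by
  have hsol := (eventually_isSolution (N := N) (p := p) (f := f) (lam₀ := lam₀)).filter_mono hl
  have hpos := (tendsto_initial_value (N := N) (p := p) (f := f) (lam₀ := lam₀)).eventually_const_lt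
    hlam |>.filter_mono hl
  have hcount := eventually_encard_zeros_eq (l := l) (F := fun v : ℝ → ℝ => v) (F' := rderiv)
    (w := w) (w' := rderiv w) (R := R) (hw.continuousOn.mono fun r hr => hr.1)
    (hw.continuousOn_rderiv.mono fun r hr => hr.1) (fun r hr => hw.hasDerivAt hr.1)
    (by rw [hw.initial_value]; exact hlam.ne') hR hs
    (hsol.mono fun v hv => ⟨hv.continuousOn.mono fun r hr => hr.1, fun r hr => hv.hasDerivAt hr.1⟩)
    hu hu'
  filter_upwards [hcount, hsol, hpos] with v hv hs hp
  rw [hs.nodes_inter_Iic hp.ne' hv.2, hv.1]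

lemma IsSolution.finite_zeros (hlam : 0 < lam₀) (h : IsSolution N p f lam₀ u) {R : ℝ}
    (hR : u R ≠ 0) (hs : ∀ r ∈ Icc 0 R, u r = 0 → rderiv u r ≠ 0) :
    {r ∈ Icc 0 R | u r = 0}.Finite :=
  RadialPLaplace.finite_zeros (h.continuousOn.mono fun r hr => hr.1)
    (fun r hr => h.hasDerivAt hr.1) (by rw [h.initial_value]; exact hlam.ne') hR hs

/-- If a solution with initial value `lam₀` has `u ≠ 0` when its energy runs out, the number of
nodes is locally constant. -/
lemma IsSolution.exists_eventually_encard_eq (hp : 1 < p) (hN : p < N) (h1 : H1 f) (h4 : H4 f)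
    (h5 : H5 p f) (hlam : 0 < lam₀) (h : IsSolution N p f lam₀ u) {r₀ : ℝ} (hr₀ : 0 ≤ r₀)
    (hE₀ : energy p f u r₀ ≤ 0) (hE : ∀ r ∈ Ico 0 r₀, 0 < energy p f u r) (hu₀ : u r₀ ≠ 0) :
    ∃ k : ℕ, ∀ᶠ v in solutionsNear N p f lam₀, (nodes v).encard = (k : ℕ∞) := by
  have hEr : ∀ r ∈ Ioc r₀ (r₀ + 1), energy p f u r < 0 := fun r hr =>
    h.energy_neg hp hN h1.1 h4 hr₀ hE₀ hu₀ hr.1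
  have hzero : ∀ {w}, IsSolution N p f lam₀ w → (∀ r ∈ Icc 0 r₀, w r = u r ∧
      rderiv w r = rderiv u r) → (∀ r, r₀ < r → energy p f w r < 0) ∧
      (∀ r ∈ Icc 0 (r₀ + 1), w r = 0 → r ∈ Ico 0 r₀ ∧ rderiv w r ≠ 0) := by
    intro w hs hwu
    have hen : ∀ r ∈ Icc 0 r₀, energy p f w r = energy p f u r := fun r hr => by
      unfold energy; rw [(hwu r hr).1, (hwu r hr).2]
    have hr₀I : r₀ ∈ Icc 0 r₀ := ⟨hr₀, le_rfl⟩
    have hneg : ∀ r, r₀ < r → energy p f w r < 0 := fun r hr =>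
      hs.energy_neg hp hN h1.1 h4 hr₀ (by rw [hen r₀ hr₀I]; exact hE₀)
        (by rw [(hwu r₀ hr₀I).1]; exact hu₀) hr
    refine ⟨hneg, fun r hr hr0 => ?_⟩
    have hlt : r < r₀ := by
      by_contra hcon
      rcases eq_or_lt_of_le (not_lt.mp hcon) with rfl | hgt
      · rw [(hwu r₀ hr₀I).1] at hr0
        exact hu₀ hr0
      · exact ne_zero_of_energy_neg hp (hneg r hgt) hr0
    refine ⟨⟨hr.1, hlt⟩, rderiv_ne_zero_of_energy_pos (f := f) hp hr0 ?_⟩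
    rw [hen r ⟨hr.1, hlt.le⟩]
    exact hE r ⟨hr.1, hlt⟩
  obtain ⟨huneg, huz⟩ := hzero h fun r _ => ⟨rfl, rfl⟩
  have hlast : r₀ < r₀ + 1 := lt_add_one r₀
  have hfin := h.finite_zeros hlam (ne_zero_of_energy_neg hp (huneg _ hlast))
    fun r hr hr0 => (huz r hr hr0).2
  refine ⟨hfin.toFinset.card, mem_iff_ultrafilter.mpr fun 𝒰 h𝒰 => ?_⟩
  obtain ⟨w, hw, hconv⟩ := exists_limit_solution hp hN h1.1 h5 𝒰 h𝒰
  have hwu : ∀ r ∈ Icc 0 r₀, w r = u r ∧ rderiv w r = rderiv u r := fun r hr => by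
    have := h.eq_of_energy_pos hp hN h1 h4 hw hr.1 fun s hs => hE s ⟨hs.1, hs.2.trans_le hr.2⟩
    exact ⟨this.1.symm, this.2.symm⟩
  obtain ⟨hwneg, hwz⟩ := hzero hw hwu
  have hsets : {r ∈ Icc 0 (r₀ + 1) | w r = 0} = {r ∈ Icc 0 (r₀ + 1) | u r = 0} := by
    ext r
    constructor
    · rintro ⟨hr, hr0⟩
      have hI := (hwz r hr hr0).1
      exact ⟨hr, (hwu r ⟨hI.1, hI.2.le⟩).1 ▸ hr0⟩
    · rintro ⟨hr, hr0⟩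
      have hI := (huz r hr hr0).1
      exact ⟨hr, (hwu r ⟨hI.1, hI.2.le⟩).1.trans hr0⟩
  have hRI : r₀ + 1 ∈ Icc 0 (r₀ + 1) := ⟨by linarith, le_rfl⟩
  have hEv := (tendsto_energy hp h1.1 ((hconv _).1.tendsto_at hRI)
    ((hconv _).2.tendsto_at hRI)).eventually_lt_const (hwneg _ hlast)
  have hcount := IsSolution.eventually_encard_nodes hlam h𝒰 hw (hconv _).1 (hconv _).2
    (ne_zero_of_energy_neg hp (hwneg _ hlast)) fun r hr hr0 => (hwz r hr hr0).2
  have hsol := (eventually_isSolution (N := N) (p := p) (f := f) (lam₀ := lam₀)).filter_mono h𝒰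
  have hgoal : ∀ᶠ v in (𝒰 : Filter (ℝ → ℝ)), (nodes v).encard = (hfin.toFinset.card : ℕ∞) := by
    filter_upwards [hEv, hcount, hsol] with v hv1 hv2 hvs
    have hall : nodes v ∩ Iic (r₀ + 1) = nodes v := by
      refine inter_eq_left.mpr fun r hr => ?_
      by_contra hcon
      refine ne_zero_of_energy_neg (f := f) hp (lt_of_le_of_lt ?_ hv1) hr.2.1
      exact hvs.antitoneOn_energy hp h1.1 hRI.1 hr.1.le (le_of_lt (not_le.mp hcon))
    rw [hall] at hv2
    rw [hv2, hsets, hfin.encard_eq_coe_toFinset_card]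
  exact hgoal

/-- If a solution with initial value `lam₀` has a double zero when its energy runs out, nearby
solutions have the nodes it has before this time and at most one more. -/
lemma IsSolution.exists_eventually_encard_eq_or (hp : 1 < p) (hN : p < N) (h1 : H1 f) (h4 : H4 f)
    (h5 : H5 p f) (hw : IsWell p f β) (hlam : 0 < lam₀) (h : IsSolution N p f lam₀ u) {r₀ : ℝ}
    (hr₀ : 0 < r₀) (hE₀ : energy p f u r₀ ≤ 0) (hE : ∀ r ∈ Ico 0 r₀, 0 < energy p f u r)
    (hu₀ : u r₀ = 0) :
    ∃ k : ℕ, ∀ᶠ v in solutionsNear N p f lam₀,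
      (nodes v).encard = (k : ℕ∞) ∨ (nodes v).encard = (k : ℕ∞) + 1 := by
  have hβ := hw.pos
  obtain ⟨ε, hε, htail⟩ := hw.exists_nodes_subsingleton hp hN h1.1 hr₀.le
  obtain ⟨r₁, hr₁0, hr₁, hur₁, hur₁0, hEr₁⟩ : ∃ r₁, 0 ≤ r₁ ∧ r₁ < r₀ ∧ |u r₁| < β / 2 ∧ u r₁ ≠ 0 ∧
      energy p f u r₁ < ε := by
    have c1 : ContinuousAt (fun r => |u r|) r₀ := (h.hasDerivAt hr₀).continuousAt.abs
    have c2 := (h.hasDerivAt_energy hp h1.1 hr₀).continuousAt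
    obtain ⟨b, hb, hbI⟩ := mem_nhdsLE_iff_exists_Icc_subset.mp (nhdsWithin_le_nhds (s := Iic r₀)
      ((c1.eventually_lt_const (by rw [hu₀, abs_zero]; positivity : |u r₀| < β / 2)).and
      ((c2.eventually_lt_const (hE₀.trans_lt hε)).and (eventually_ge_nhds hr₀))))
    have hbI' : b ∈ Icc b r₀ := ⟨le_rfl, le_of_lt hb⟩
    refine ⟨b, (hbI hbI').2.2, hb, (hbI hbI').1, fun hb0 => ?_, (hbI hbI').2.1⟩
    -- The well lemma makes `u` injective on `[b, r₀]`, and `u` vanishes at `r₀`.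
    have hinj := h.injOn_well hp hw (hbI hbI').2.2
      (fun r hr => (hbI hr).1.le.trans (by linarith))
      fun r hr => hE r ⟨(hbI hbI').2.2.trans hr.1.le, hr.2⟩
    exact (ne_of_lt hb) (hinj hbI' ⟨le_of_lt hb, le_rfl⟩ (hb0.trans hu₀.symm))
  have hsimple : ∀ r ∈ Icc 0 r₁, u r = 0 → rderiv u r ≠ 0 := fun r hr hr0 =>
    rderiv_ne_zero_of_energy_pos (f := f) hp hr0 (hE r ⟨hr.1, hr.2.trans_lt hr₁⟩)
  have hfin := h.finite_zeros hlam hur₁0 hsimple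
  refine ⟨hfin.toFinset.card, mem_iff_ultrafilter.mpr fun 𝒰 h𝒰 => ?_⟩
  obtain ⟨w, hws, hconv⟩ := exists_limit_solution hp hN h1.1 h5 𝒰 h𝒰
  have hwu : ∀ r ∈ Icc 0 r₁, u r = w r ∧ rderiv u r = rderiv w r := fun r hr =>
    h.eq_of_energy_pos hp hN h1 h4 hws hr.1 fun s hs =>
      hE s ⟨hs.1, hs.2.trans_le (hr.2.trans hr₁.le)⟩
  have hRI : r₁ ∈ Icc 0 r₁ := ⟨hr₁0, le_rfl⟩
  have hcv : TendstoUniformlyOn (fun v : ℝ → ℝ => v) u (𝒰 : Filter (ℝ → ℝ)) (Icc 0 r₁) :=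
    (hconv r₁).1.congr_right fun r hr => (hwu r hr).1.symm
  have hcv' : TendstoUniformlyOn rderiv (rderiv u) (𝒰 : Filter (ℝ → ℝ)) (Icc 0 r₁) :=
    (hconv r₁).2.congr_right fun r hr => (hwu r hr).2.symm
  have hcount := IsSolution.eventually_encard_nodes hlam h𝒰 h hcv hcv' hur₁0 hsimple
  have hsol := (eventually_isSolution (N := N) (p := p) (f := f) (lam₀ := lam₀)).filter_mono h𝒰
  have hEv := (tendsto_energy hp h1.1 (hcv.tendsto_at hRI)
    (hcv'.tendsto_at hRI)).eventually_lt_const hEr₁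
  have hsmall := (hcv.tendsto_at hRI).abs.eventually_lt_const hur₁
  have hgoal : ∀ᶠ v in (𝒰 : Filter (ℝ → ℝ)), (nodes v).encard = (hfin.toFinset.card : ℕ∞) ∨
      (nodes v).encard = (hfin.toFinset.card : ℕ∞) + 1 := by
    filter_upwards [hcount, hsol, hEv, hsmall] with v hv1 hvs hv2 hv3
    have hsub := htail _ v hvs r₁ hr₁0 hr₁.le hv3.le hv2
    have hunion : nodes v = (nodes v ∩ Iic r₁) ∪ (nodes v ∩ Ioi r₁) := by
      rw [← inter_union_distrib_left, Iic_union_Ioi, inter_univ]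
    have hdisj : Disjoint (nodes v ∩ Iic r₁) (nodes v ∩ Ioi r₁) :=
      (Iic_disjoint_Ioi le_rfl).mono inter_subset_right inter_subset_right
    rw [hunion, encard_union_eq hdisj, hv1, hfin.encard_eq_coe_toFinset_card]
    rcases hsub.eq_empty_or_singleton with h0 | ⟨s, h0⟩
    · left; rw [h0, encard_empty, add_zero]
    · right; rw [h0, encard_singleton]
  exact hgoal

/-- Either the number of nodes is locally constant near `lam₀`, or it varies by at most one and
there is a compactly supported solution with initial value `lam₀`. -/
theorem eventually_nodes_dichotomy (hp : 1 < p) (hN : p < N) (h1 : H1 f) (h2 : H2 f)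
    (h3 : H3 p f) (h4 : H4 f) (h5 : H5 p f) (hlam : 0 < lam₀) :
    (∃ k : ℕ, ∀ᶠ v in solutionsNear N p f lam₀, (nodes v).encard = (k : ℕ∞)) ∨
      ((∃ k : ℕ, ∀ᶠ v in solutionsNear N p f lam₀,
        (nodes v).encard = (k : ℕ∞) ∨ (nodes v).encard = (k : ℕ∞) + 1) ∧
      ∃ u : ℝ → ℝ, IsSolution N p f lam₀ u ∧ IsCompact (radialSupport u)) := by
  rcases eq_or_neBot (solutionsNear N p f lam₀) with hbot | hne
  · exact Or.inl ⟨0, by rw [hbot]; exact eventually_bot⟩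
  obtain ⟨β, hw⟩ := exists_isWell h1 h2 h3.1
  obtain ⟨u, hu, -⟩ := exists_limit_solution hp hN h1.1 h5 (Ultrafilter.of _)
    (Ultrafilter.of_le (solutionsNear N p f lam₀))
  obtain ⟨r₀, hr₀, hE₀, hE⟩ := hu.exists_first_energy_nonpos hp hN h1.1 h4 h5 hw
  by_cases hu₀ : u r₀ = 0
  · have hr₀' : 0 < r₀ := lt_of_le_of_ne hr₀ (by
      rintro rfl
      exact hlam.ne' (hu.initial_value ▸ hu₀))
    have hd : rderiv u r₀ = 0 := by
      have h7 := abs_rderiv_rpow (f := f) (u := u) hp r₀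
      rw [hu₀, primitive_zero, sub_zero] at h7
      have h8 : |rderiv u r₀| ^ p = 0 := le_antisymm
        (h7 ▸ mul_nonpos_of_nonneg_of_nonpos (by linarith [one_lt_conj hp]) hE₀)
        (Real.rpow_nonneg (abs_nonneg _) _)
      exact abs_eq_zero.mp ((Real.rpow_eq_zero (abs_nonneg _) (by linarith)).mp h8)
    exact Or.inr ⟨hu.exists_eventually_encard_eq_or hp hN h1 h4 h5 hw hlam hr₀' hE₀ hE hu₀,
      hu.exists_compactSupport hp h1 hr₀' hu₀ hd⟩
  · exact Or.inl (hu.exists_eventually_encard_eq hp hN h1 h4 h5 hlam hr₀ hE₀ hE hu₀)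

end Main

end RadialPLaplace

open RadialPLaplace in
theorem lemma5p5 (N : ℕ) (p : ℝ) (hp : 1 < p) (hN : p < (N : ℝ)) (f : ℝ → ℝ)
    (h1 : H1 f) (h2 : H2 f) (h3 : H3 p f) (h4 : H4 f) (h5 : H5 p f)
    (lam₀ : ℝ) (hlam₀ : 0 < lam₀) :
    (∃ δ : ℝ, 0 < δ ∧ ∃ k : ℕ, ∀ lam : ℝ, 0 < lam → |lam - lam₀| < δ →
      ∀ u : ℝ → ℝ, IsSolution N p f lam u →
        (nodes u).encard = (k : ℕ∞) ∨ (nodes u).encard = (k : ℕ∞) + 1) ∧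
    ((¬ ∃ δ : ℝ, 0 < δ ∧ ∃ k : ℕ, ∀ lam : ℝ, 0 < lam → |lam - lam₀| < δ →
      ∀ u : ℝ → ℝ, IsSolution N p f lam u → (nodes u).encard = (k : ℕ∞)) →
      ∃ u : ℝ → ℝ, IsSolution N p f lam₀ u ∧ IsCompact (radialSupport u)) := by
  rcases eventually_nodes_dichotomy hp hN h1 h2 h3 h4 h5 hlam₀ with ⟨k, hk⟩ | ⟨⟨k, hk⟩, hcomp⟩
  · obtain ⟨δ, hδ, hconst⟩ := exists_delta_of_eventually hk
    exact ⟨⟨δ, hδ, k, fun lam hlam hd u hu => Or.inl (hconst lam hlam hd u hu)⟩,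
      fun hno => absurd ⟨δ, hδ, k, hconst⟩ hno⟩
  · obtain ⟨δ, hδ, hvar⟩ := exists_delta_of_eventually hk
    exact ⟨⟨δ, hδ, k, hvar⟩, fun _ => hcomp⟩
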